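/- Let $\psi:\mathbb R\to\mathbb R$ satisfy $\psi(R)\to0$ as $R\to\infty$, and let $\delta>0$, $K\in\mathbb R$, $\tau>0$. Conventions. If a real random variable $U$ has a continuously differentiable density $p$, its score function is $\rho_U=p'/p$, its Fisher information is $J(U)=\mathbb E\,\rho_U(U)^2$, and, when $U$ has finite variance, $J_{\rm st}(U)=\operatorname{Var}(U)\,J(U)-1$. For $\beta\in(0,1)$ and random variables $X,Y$ on one probability space, $$\Delta(X,Y,\beta)=\mathbb E\Big(\sqrt\beta\,\rho_X(X)+\sqrt{1-\beta}\,\rho_Y(Y)-\tilde\rho\big(\sqrt\beta X+\sqrt{1-\beta}\,Y\big)\Big)^2,$$ where $\tilde\rho$ is the score function of $\sqrt\beta X+\sqrt{1-\beta}\,Y$. The class $\mathcal C_\psi$ consists of the square-integrable random variables $X$, with variance $v_X$, such that $\mathbb E\big[X^2\,\mathbf 1(|X|\ge R\sqrt{v_X})\big]\le v_X\,\psi(R)$ for all $R>0$. Proposition. There is a function $\nu=\nu_{\psi,\delta,K,\tau}:\mathbb R\to\mathbb R$ with $\nu(\varepsilon)\to0$ as $\varepsilon\to0$ (in particular $\nu(0)=0$)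 such that the following holds. Let $S,T$ be square-integrable, possibly dependent, real random variables on a common probability space with $\max(\operatorname{Var}S,\operatorname{Var}T)\le K\tau$. Let $Z_S,Z_T$ be $N(0,\tau)$ random variables, independent of each other and with $(Z_S,Z_T)$ independent of $(S,T)$, and put $X=S+Z_S$, $Y=T+Z_T$. If $X,Y\in\mathcal C_\psi$ and $\beta\in(\delta,1-\delta)$, then $X$, $Y$ and $\sqrt\beta X+\sqrt{1-\beta}\,Y$ have continuously differentiable densities, $J(X)$ and $\Delta(X,Y,\beta)$ are finite, and $$J_{\rm st}(X)\le\nu\big(\Delta(X,Y,\beta)\big).$$ -/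

import Mathlib

open MeasureTheory ProbabilityTheory Filter
open scoped Topology NNReal

noncomputable section

/-- `p` is a continuously differentiable density of the real random variable `U`
on the probability space `(Ω, P)`. -/
structure IsC1Density {Ω : Type*} [MeasurableSpace Ω] (P : Measure Ω) (U : Ω → ℝ)
    (p : ℝ → ℝ) : Prop where
  aemeasurable : AEMeasurable U P
  contDiff : ContDiff ℝ 1 p
  nonneg : ∀ x, 0 ≤ p x
  map_eq : P.map U = volume.withDensity (fun x => ENNReal.ofReal (p x))

/-- A continuously differentiable density is unique. -/
theorem IsC1Density.unique {Ω : Type*} [MeasurableSpace Ω] {P : Measure Ω}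
    [IsProbabilityMeasure P] {U : Ω → ℝ} {p q : ℝ → ℝ}
    (hp : IsC1Density P U p) (hq : IsC1Density P U q) : p = q := by
  have hpm : Measurable fun x => ENNReal.ofReal (p x) :=
    hp.contDiff.continuous.measurable.ennreal_ofReal
  have hqm : Measurable fun x => ENNReal.ofReal (q x) :=
    hq.contDiff.continuous.measurable.ennreal_ofReal
  have h : (fun x => ENNReal.ofReal (p x)) =ᵐ[volume] fun x => ENNReal.ofReal (q x) :=
    (withDensity_eq_iff_of_sigmaFinite hpm.aemeasurable hqm.aemeasurable).1
      (hp.map_eq.symm.trans hq.map_eq)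
  refine (hp.contDiff.continuous.ae_eq_iff_eq volume hq.contDiff.continuous).1 ?_
  filter_upwards [h] with x hx
  exact (ENNReal.ofReal_eq_ofReal_iff (hp.nonneg x) (hq.nonneg x)).1 hx

open Classical in
/-- The continuously differentiable density of `U` (by convention `0` if there is none). -/
def density {Ω : Type*} [MeasurableSpace Ω] (P : Measure Ω) (U : Ω → ℝ) : ℝ → ℝ :=
  if h : ∃ p, IsC1Density P U p then h.choose else 0

theorem IsC1Density.density_eq {Ω : Type*} [MeasurableSpace Ω] {P : Measure Ω}
    [IsProbabilityMeasure P] {U : Ω → ℝ} {p : ℝ → ℝ} (hp : IsC1Density P U p) :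
    density P U = p := by
  have h : ∃ p, IsC1Density P U p := ⟨p, hp⟩
  rw [density, dif_pos h]
  exact h.choose_spec.unique hp

/-- The score function `ρ_U = p' / p`, where `p` is the density of `U`. -/
def score {Ω : Type*} [MeasurableSpace Ω] (P : Measure Ω) (U : Ω → ℝ) : ℝ → ℝ :=
  fun u => deriv (density P U) u / density P U u

/-- The Fisher information `J(U) = E ρ_U(U)²`. -/
def fisherInfo {Ω : Type*} [MeasurableSpace Ω] (P : Measure Ω) (U : Ω → ℝ) : ℝ :=
  ∫ ω, score P U (U ω) ^ 2 ∂P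

/-- The standardised Fisher information `J_st(U) = Var(U) J(U) - 1`. -/
def fisherInfoSt {Ω : Type*} [MeasurableSpace Ω] (P : Measure Ω) (U : Ω → ℝ) : ℝ :=
  variance U P * fisherInfo P U - 1

/-- The normalised sum `√β X + √(1-β) Y`. -/
def mix {Ω : Type*} (β : ℝ) (X Y : Ω → ℝ) : Ω → ℝ :=
  fun ω => √β * X ω + √(1 - β) * Y ω

/-- The random variable
`√β ρ_X(X) + √(1-β) ρ_Y(Y) - ρ̃(√β X + √(1-β) Y)`,
where `ρ̃` is the score function of `√β X + √(1-β) Y`. -/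
def scoreDefect {Ω : Type*} [MeasurableSpace Ω] (P : Measure Ω) (X Y : Ω → ℝ) (β : ℝ) :
    Ω → ℝ :=
  fun ω => √β * score P X (X ω) + √(1 - β) * score P Y (Y ω)
    - score P (mix β X Y) (mix β X Y ω)

/-- `Δ(X, Y, β)`, the mean square of the score defect. -/
def scoreDelta {Ω : Type*} [MeasurableSpace Ω] (P : Measure Ω) (X Y : Ω → ℝ) (β : ℝ) : ℝ :=
  ∫ ω, scoreDefect P X Y β ω ^ 2 ∂P

/-- Membership of `X` in the class `C_ψ`: `X` is square integrable, with variance `v`, and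
`E[X² 1(|X| ≥ R √v)] ≤ v ψ(R)` for all `R > 0`. -/
def TailClass {Ω : Type*} [MeasurableSpace Ω] (ψ : ℝ → ℝ) (P : Measure Ω) (X : Ω → ℝ) :
    Prop :=
  MemLp X 2 P ∧ ∀ R : ℝ, 0 < R →
    ∫ ω, {ω | R * √(variance X P) ≤ |X ω|}.indicator (fun ω => X ω ^ 2) ω ∂P
      ≤ variance X P * ψ R

end

/-! Adding `N(0,τ)` noise makes everything regular: the density of `X` is a Gaussian convolution,
and `ρ_X(X) = -E[Z_S | X]/τ`. The normalised sum of the two noises is again `N(0,τ)` and independent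
of `mix β S T`, so the same holds for `Y` and for `mix β X Y`; dependence between `S` and `T` does
no harm.

The second moments in the class are uniformly bounded, hence `S` and `T` are uniformly tight. This
gives uniform constants on bounded sets: the scores are bounded and Lipschitz
(`exists_score_bound`), and the law of `(X,Y)` gives a square of half-side `r` mass at least `c r²`
(`le_measureReal_square`). A small `Δ` therefore makes `√β ρ_X(x) + √(1-β) ρ_Y(y) - ρ̃(√β x + √(1-β)
y)` uniformly small on a large box (`exists_forall_abs_le_of_integral_sq_lt`). Eliminating `ρ_Y` and
`ρ̃` leaves an approximate Cauchy equation for `ρ_X`, whose stability makes `ρ_X` nearly affine on a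
large interval (`exists_affine_approx`).

Finally `J_st(X) ≤ Var(X) E(ρ_X(X) - A - B X)²` for all `A`, `B` (`fisherInfoSt_add_gauss_le`).
Inside the interval the integrand is small. Outside, the squared score is dominated by the
conditional second moment of the noise, and the tail condition makes both contributions small
(`integral_sq_score_sub_affine_le`). All choices are uniform over the class and `J_st` is bounded on
it, so a supremum over attained values serves as `ν`. -/

noncomputable section

/-! ### The Gaussian kernel and its derivatives -/

/-- First derivative of the centred Gaussian density. -/
def gaussDeriv (τ : ℝ≥0) (x : ℝ) : ℝ := -(x / τ) * gaussianPDFReal 0 τ x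

/-- Second derivative of the centred Gaussian density. -/
def gaussDeriv2 (τ : ℝ≥0) (x : ℝ) : ℝ := (x ^ 2 / τ ^ 2 - 1 / τ) * gaussianPDFReal 0 τ x

/-- The convolution `x ↦ ∫ k (x - s) dμ(s)`. -/
def convAvg (k : ℝ → ℝ) (μ : Measure ℝ) (x : ℝ) : ℝ := ∫ s, k (x - s) ∂μ

theorem hasDerivAt_gaussianPDFReal {τ : ℝ≥0} (hτ : τ ≠ 0) (x : ℝ) :
    HasDerivAt (gaussianPDFReal 0 τ) (gaussDeriv τ x) x := by
  have h0 : (τ : ℝ) ≠ 0 := by exact_mod_cast hτ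
  have h1 : HasDerivAt (fun y : ℝ => -(y - 0) ^ 2 / (2 * τ)) (-(x / τ)) x := by
    refine ((((hasDerivAt_id x).sub_const 0).pow 2).neg.div_const (2 * (τ : ℝ))).congr_deriv ?_
    simp only [id, sub_zero, Nat.cast_ofNat, Nat.add_one_sub_one, pow_one]
    field_simp
  have := (h1.exp).const_mul (√(2 * Real.pi * τ))⁻¹
  rw [gaussianPDFReal_def]
  refine this.congr_deriv ?_
  rw [gaussDeriv, gaussianPDFReal_def]
  ring

theorem hasDerivAt_gaussDeriv {τ : ℝ≥0} (hτ : τ ≠ 0) (x : ℝ) :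
    HasDerivAt (gaussDeriv τ) (gaussDeriv2 τ x) x := by
  have h0 : (τ : ℝ) ≠ 0 := by exact_mod_cast hτ
  have h1 : HasDerivAt (fun y : ℝ => -(y / (τ : ℝ))) (-(1 / τ)) x :=
    ((hasDerivAt_id x).div_const _).neg
  have := h1.mul (hasDerivAt_gaussianPDFReal hτ x)
  change HasDerivAt (fun y => -(y / (τ : ℝ)) * gaussianPDFReal 0 τ y) _ x
  refine this.congr_deriv ?_
  rw [gaussDeriv2, gaussDeriv]
  field_simp
  ring

theorem continuous_gaussianPDFReal_zero {τ : ℝ≥0} (hτ : τ ≠ 0) :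
    Continuous (gaussianPDFReal 0 τ) :=
  continuous_iff_continuousAt.2 fun x => (hasDerivAt_gaussianPDFReal hτ x).continuousAt

theorem continuous_gaussDeriv {τ : ℝ≥0} (hτ : τ ≠ 0) : Continuous (gaussDeriv τ) :=
  continuous_iff_continuousAt.2 fun x => (hasDerivAt_gaussDeriv hτ x).continuousAt

theorem continuous_gaussDeriv2 {τ : ℝ≥0} (hτ : τ ≠ 0) : Continuous (gaussDeriv2 τ) := by
  have := continuous_gaussianPDFReal_zero hτ
  unfold gaussDeriv2
  fun_prop

theorem exists_bound_one_add_sq_mul_gaussianPDFReal {τ : ℝ≥0} (hτ : τ ≠ 0) :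
    ∃ C, 0 < C ∧ ∀ x, (1 + x ^ 2) * gaussianPDFReal 0 τ x ≤ C := by
  have h0 : (0 : ℝ) < τ := by exact_mod_cast pos_iff_ne_zero.2 hτ
  have hpi := Real.pi_pos
  refine ⟨(√(2 * Real.pi * τ))⁻¹ * (1 + 2 * τ), by positivity, fun x => ?_⟩
  have hle : (1 + x ^ 2) * Real.exp (-(x - 0) ^ 2 / (2 * τ)) ≤ 1 + 2 * τ := by
    have e1 : -(x - 0) ^ 2 / (2 * (τ : ℝ)) = -(x ^ 2 / (2 * τ)) := by
      rw [sub_zero, neg_div]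
    rw [e1, Real.exp_neg, mul_inv_le_iff₀ (Real.exp_pos _)]
    have h2 := Real.add_one_le_exp (x ^ 2 / (2 * (τ : ℝ)))
    have h3 : 0 ≤ x ^ 2 / (2 * (τ : ℝ)) := by positivity
    have h4 : 2 * (τ : ℝ) * (x ^ 2 / (2 * τ)) = x ^ 2 := by field_simp
    nlinarith
  calc (1 + x ^ 2) * gaussianPDFReal 0 τ x
      = (√(2 * Real.pi * τ))⁻¹ * ((1 + x ^ 2) * Real.exp (-(x - 0) ^ 2 / (2 * τ))) := by
        rw [gaussianPDFReal_def]; ring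
    _ ≤ _ := by gcongr

/-- Each function is the kernel times a polynomial of size `O(1 + x²)`. The first three bounds
justify differentiating convolutions twice; the last serves the Cauchy–Schwarz bound on the score.
-/
theorem exists_gauss_bound {τ : ℝ≥0} (hτ : τ ≠ 0) :
    ∃ C, 0 < C ∧ ∀ x, |gaussianPDFReal 0 τ x| ≤ C ∧ |gaussDeriv τ x| ≤ C ∧
      |gaussDeriv2 τ x| ≤ C ∧ |(x / τ) ^ 2 * gaussianPDFReal 0 τ x| ≤ C := by
  have h0 : (0 : ℝ) < τ := by exact_mod_cast pos_iff_ne_zero.2 hτ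
  obtain ⟨C, hC, h⟩ := exists_bound_one_add_sq_mul_gaussianPDFReal hτ
  have key : ∀ k : ℝ, 0 ≤ k → ∀ x p, |p| ≤ k * (1 + x ^ 2) →
      |p * gaussianPDFReal 0 τ x| ≤ k * C := by
    intro k hk x p hp
    have hg := gaussianPDFReal_nonneg 0 τ x
    rw [abs_mul, abs_of_nonneg hg]
    calc |p| * gaussianPDFReal 0 τ x ≤ (k * (1 + x ^ 2)) * gaussianPDFReal 0 τ x := by gcongr
      _ = k * ((1 + x ^ 2) * gaussianPDFReal 0 τ x) := by ring
      _ ≤ k * C := by gcongr; exact h x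
  have hk : (0 : ℝ) ≤ 1 + 1 / τ + 1 / τ ^ 2 := by positivity
  have hi1 : (0 : ℝ) < 1 / τ := by positivity
  have hi2 : (0 : ℝ) < 1 / τ ^ 2 := by positivity
  refine ⟨(1 + 1 / τ + 1 / τ ^ 2) * C, by positivity, fun x => ⟨?_, ?_, ?_, ?_⟩⟩
  · have := key _ hk x 1 (by rw [abs_one]; nlinarith [sq_nonneg x])
    simpa using this
  · refine key _ hk x _ ?_
    rw [abs_neg, abs_div, abs_of_pos h0]
    have : |x| ≤ 1 + x ^ 2 := abs_le.2 ⟨by nlinarith, by nlinarith⟩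
    calc |x| / τ = 1 / τ * |x| := by ring
      _ ≤ 1 / τ * (1 + x ^ 2) := by gcongr
      _ ≤ _ := by gcongr; linarith
  · refine key _ hk x _ ?_
    have e : x ^ 2 / (τ : ℝ) ^ 2 = 1 / τ ^ 2 * x ^ 2 := by ring
    rw [abs_le, e]
    constructor <;>
      nlinarith [sq_nonneg x, mul_nonneg hi1.le (sq_nonneg x), mul_nonneg hi2.le (sq_nonneg x)]
  · refine key _ hk x _ ?_
    have e : (x / (τ : ℝ)) ^ 2 = 1 / τ ^ 2 * x ^ 2 := by ring
    rw [e, abs_of_nonneg (by positivity)]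
    nlinarith [sq_nonneg x, mul_nonneg hi1.le (sq_nonneg x), mul_nonneg hi2.le (sq_nonneg x)]

/-! ### Convolution of a law with the Gaussian kernel -/

section convAvg

variable {μ : Measure ℝ}

theorem integrable_comp_sub [IsFiniteMeasure μ] {k : ℝ → ℝ} (hk : Continuous k) {C : ℝ}
    (hC : ∀ x, |k x| ≤ C) (x : ℝ) : Integrable (fun s => k (x - s)) μ :=
  Integrable.of_bound (by fun_prop) C (ae_of_all _ fun s => hC (x - s))

theorem hasDerivAt_convAvg [IsFiniteMeasure μ] {k k' : ℝ → ℝ} (hk : Continuous k)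
    (hk' : Continuous k') {C : ℝ} (hC : ∀ x, |k x| ≤ C) (hC' : ∀ x, |k' x| ≤ C)
    (hd : ∀ x, HasDerivAt k (k' x) x) (x : ℝ) :
    HasDerivAt (convAvg k μ) (convAvg k' μ x) x := by
  refine (hasDerivAt_integral_of_dominated_loc_of_deriv_le (s := Set.univ)
    (F := fun x s => k (x - s)) (F' := fun x s => k' (x - s)) (bound := fun _ => C)
    univ_mem ?_ (integrable_comp_sub hk hC x) ?_ ?_ ?_ ?_).2
  · exact Eventually.of_forall fun y => by fun_prop
  · fun_prop
  · exact ae_of_all _ fun s y _ => hC' (y - s)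
  · exact integrable_const _
  · exact ae_of_all _ fun s y _ => (hd (y - s)).comp_sub_const y s

theorem abs_convAvg_le [IsProbabilityMeasure μ] {k : ℝ → ℝ} {C : ℝ} (hC : ∀ x, |k x| ≤ C)
    (x : ℝ) : |convAvg k μ x| ≤ C := by
  have := norm_integral_le_of_norm_le_const (μ := μ) (f := fun s => k (x - s)) (C := C)
    (ae_of_all _ fun s => hC (x - s))
  simpa [convAvg] using this

variable {τ : ℝ≥0}

theorem hasDerivAt_convAvg_gauss [IsFiniteMeasure μ] (hτ : τ ≠ 0) (x : ℝ) :
    HasDerivAt (convAvg (gaussianPDFReal 0 τ) μ) (convAvg (gaussDeriv τ) μ x) x := by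
  obtain ⟨C, -, hC⟩ := exists_gauss_bound hτ
  exact hasDerivAt_convAvg (continuous_gaussianPDFReal_zero hτ) (continuous_gaussDeriv hτ)
    (fun x => (hC x).1) (fun x => (hC x).2.1) (hasDerivAt_gaussianPDFReal hτ) x

theorem hasDerivAt_convAvg_gaussDeriv [IsFiniteMeasure μ] (hτ : τ ≠ 0) (x : ℝ) :
    HasDerivAt (convAvg (gaussDeriv τ) μ) (convAvg (gaussDeriv2 τ) μ x) x := by
  obtain ⟨C, -, hC⟩ := exists_gauss_bound hτ
  exact hasDerivAt_convAvg (continuous_gaussDeriv hτ) (continuous_gaussDeriv2 hτ)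
    (fun x => (hC x).2.1) (fun x => (hC x).2.2.1) (hasDerivAt_gaussDeriv hτ) x

theorem continuous_convAvg_gauss [IsFiniteMeasure μ] (hτ : τ ≠ 0) :
    Continuous (convAvg (gaussianPDFReal 0 τ) μ) :=
  continuous_iff_continuousAt.2 fun x => (hasDerivAt_convAvg_gauss hτ x).continuousAt

theorem continuous_convAvg_gaussDeriv [IsFiniteMeasure μ] (hτ : τ ≠ 0) :
    Continuous (convAvg (gaussDeriv τ) μ) :=
  continuous_iff_continuousAt.2 fun x => (hasDerivAt_convAvg_gaussDeriv hτ x).continuousAt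

theorem contDiff_convAvg_gauss [IsFiniteMeasure μ] (hτ : τ ≠ 0) :
    ContDiff ℝ 1 (convAvg (gaussianPDFReal 0 τ) μ) := by
  refine contDiff_one_iff_deriv.2 ⟨fun x => (hasDerivAt_convAvg_gauss hτ x).differentiableAt, ?_⟩
  rw [funext fun x => (hasDerivAt_convAvg_gauss (μ := μ) hτ x).deriv]
  exact continuous_convAvg_gaussDeriv hτ

theorem convAvg_gauss_nonneg (x : ℝ) : 0 ≤ convAvg (gaussianPDFReal 0 τ) μ x :=
  integral_nonneg fun _ => gaussianPDFReal_nonneg 0 τ _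

theorem convAvg_gauss_pos [IsProbabilityMeasure μ] (hτ : τ ≠ 0) (x : ℝ) :
    0 < convAvg (gaussianPDFReal 0 τ) μ x := by
  obtain ⟨C, -, hC⟩ := exists_gauss_bound hτ
  rw [convAvg, integral_pos_iff_support_of_nonneg (fun _ => gaussianPDFReal_nonneg 0 τ _)
    (integrable_comp_sub (continuous_gaussianPDFReal_zero hτ) (fun x => (hC x).1) x)]
  have : (Function.support fun s => gaussianPDFReal 0 τ (x - s)) = Set.univ := by
    ext s
    simpa using (gaussianPDFReal_pos 0 τ (x - s) hτ).ne'
  rw [this]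
  simp

/-- Cauchy–Schwarz: the squared score is dominated by the conditional second moment of the
noise. -/
theorem sq_score_mul_le [IsProbabilityMeasure μ] (hτ : τ ≠ 0) (x : ℝ) :
    (convAvg (gaussDeriv τ) μ x / convAvg (gaussianPDFReal 0 τ) μ x) ^ 2
        * convAvg (gaussianPDFReal 0 τ) μ x
      ≤ convAvg (fun z => (z / τ) ^ 2 * gaussianPDFReal 0 τ z) μ x := by
  obtain ⟨C, -, hC⟩ := exists_gauss_bound hτ
  have hg := continuous_gaussianPDFReal_zero hτ
  have hpos := convAvg_gauss_pos (μ := μ) hτ x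
  have i0 := integrable_comp_sub (μ := μ) hg (fun x => (hC x).1) x
  have i1 := integrable_comp_sub (μ := μ) (continuous_gaussDeriv hτ) (fun x => (hC x).2.1) x
  have i2 := integrable_comp_sub (μ := μ) (k := fun z => (z / τ) ^ 2 * gaussianPDFReal 0 τ z)
    (by fun_prop) (fun x => (hC x).2.2.2) x
  set l := convAvg (gaussDeriv τ) μ x / convAvg (gaussianPDFReal 0 τ) μ x with hl
  -- The average of `((x - s)/τ + l)²` against the kernel is nonnegative; taking `l` to be the score
  -- turns this into Cauchy–Schwarz.
  have h1 : 0 ≤ ∫ s, ((((x - s) / τ) ^ 2 * gaussianPDFReal 0 τ (x - s)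
      - 2 * l * gaussDeriv τ (x - s)) + l ^ 2 * gaussianPDFReal 0 τ (x - s)) ∂μ := by
    refine integral_nonneg fun s => ?_
    have e : (((x - s) / τ) ^ 2 * gaussianPDFReal 0 τ (x - s)
      - 2 * l * gaussDeriv τ (x - s)) + l ^ 2 * gaussianPDFReal 0 τ (x - s)
      = ((x - s) / τ + l) ^ 2 * gaussianPDFReal 0 τ (x - s) := by
      rw [gaussDeriv]; ring
    change 0 ≤ (((x - s) / τ) ^ 2 * gaussianPDFReal 0 τ (x - s)
      - 2 * l * gaussDeriv τ (x - s)) + l ^ 2 * gaussianPDFReal 0 τ (x - s)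
    rw [e]
    exact mul_nonneg (sq_nonneg _) (gaussianPDFReal_nonneg _ _ _)
  rw [integral_add (f := fun s => ((x - s) / τ) ^ 2 * gaussianPDFReal 0 τ (x - s)
      - 2 * l * gaussDeriv τ (x - s)) (i2.sub (i1.const_mul _)) (i0.const_mul _),
    integral_sub i2 (i1.const_mul _), integral_const_mul, integral_const_mul] at h1
  change 0 ≤ convAvg (fun z => (z / τ) ^ 2 * gaussianPDFReal 0 τ z) μ x
    - 2 * l * convAvg (gaussDeriv τ) μ x + l ^ 2 * convAvg (gaussianPDFReal 0 τ) μ x at h1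
  have e : convAvg (gaussDeriv τ) μ x = l * convAvg (gaussianPDFReal 0 τ) μ x := by
    rw [hl]; field_simp
  rw [e] at h1
  nlinarith

end convAvg

/-! ### Density and score of a variable with independent Gaussian noise -/

section noise

variable {Ω : Type*} [MeasurableSpace Ω] {P : Measure Ω} [IsProbabilityMeasure P]
  {τ : ℝ≥0} {S Z : Ω → ℝ}

/-- Joint law of `(S + Z, S)` for an independent centred Gaussian `Z`. -/
theorem map_add_gauss_prod (hτ : τ ≠ 0) (hS : AEMeasurable S P)
    (hZ : HasLaw Z (gaussianReal 0 τ) P) (hSZ : IndepFun S Z P) :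
    P.map (fun ω => ((S + Z) ω, S ω)) = (volume.prod (P.map S)).withDensity
      (fun p => ((gaussianPDFReal 0 τ (p.1 - p.2)).toNNReal : ENNReal)) := by
  have hZm := hZ.aemeasurable
  have : IsProbabilityMeasure (P.map S) := Measure.isProbabilityMeasure_map hS
  have hgm : Measurable (fun p : ℝ × ℝ =>
      ((gaussianPDFReal 0 τ (p.1 - p.2)).toNNReal : ENNReal)) := by
    have := measurable_gaussianPDFReal 0 τ
    fun_prop
  refine Measure.ext_of_lintegral _ fun F hF => ?_
  have hlaw := (indepFun_iff_map_prod_eq_prod_map_map hS hZm).1 hSZ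
  rw [hZ.map_eq] at hlaw
  have e1 : P.map (fun ω => ((S + Z) ω, S ω))
      = (P.map (fun ω => (S ω, Z ω))).map (fun p : ℝ × ℝ => (p.1 + p.2, p.1)) := by
    rw [AEMeasurable.map_map_of_aemeasurable (by fun_prop) (by fun_prop)]
    rfl
  rw [e1, hlaw, lintegral_map hF (by fun_prop), lintegral_prod _ (by fun_prop),
    lintegral_withDensity_eq_lintegral_mul _ hgm hF, lintegral_prod_symm _ (by fun_prop)]
  refine lintegral_congr fun s => ?_
  rw [gaussianReal_of_var_ne_zero 0 hτ,
    lintegral_withDensity_eq_lintegral_mul _ (measurable_gaussianPDF 0 τ) (by fun_prop),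
    -- Translation invariance replaces the noise variable by `x - s`, with `x` the value of the sum.
    ← lintegral_sub_right_eq_self _ s]
  refine lintegral_congr fun x => ?_
  simp only [Pi.mul_apply, gaussianPDF, add_sub_cancel]
  rfl

theorem isC1Density_add_gauss (hτ : τ ≠ 0) (hS : AEMeasurable S P)
    (hZ : HasLaw Z (gaussianReal 0 τ) P) (hSZ : IndepFun S Z P) :
    IsC1Density P (S + Z) (convAvg (gaussianPDFReal 0 τ) (P.map S)) := by
  have hZm := hZ.aemeasurable
  have : IsProbabilityMeasure (P.map S) := Measure.isProbabilityMeasure_map hS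
  obtain ⟨C, -, hC⟩ := exists_gauss_bound hτ
  have hgm := measurable_gaussianPDFReal 0 τ
  refine ⟨hS.add hZm, contDiff_convAvg_gauss hτ, convAvg_gauss_nonneg, ?_⟩
  have e1 : P.map (S + Z) = (P.map (fun ω => ((S + Z) ω, S ω))).map Prod.fst := by
    rw [AEMeasurable.map_map_of_aemeasurable (by fun_prop) (by fun_prop)]
    rfl
  refine Measure.ext_of_lintegral _ fun F hF => ?_
  rw [e1, map_add_gauss_prod hτ hS hZ hSZ, lintegral_map hF measurable_fst,
    lintegral_withDensity_eq_lintegral_mul _ (by fun_prop) (by fun_prop),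
    lintegral_prod _ (by fun_prop), lintegral_withDensity_eq_lintegral_mul _ _ hF]
  · refine lintegral_congr fun x => ?_
    simp only [Pi.mul_apply]
    rw [lintegral_mul_const _ (by fun_prop), convAvg, ofReal_integral_eq_lintegral_ofReal
      (integrable_comp_sub (continuous_gaussianPDFReal_zero hτ) (fun x => (hC x).1) x)
      (ae_of_all _ fun s => gaussianPDFReal_nonneg 0 τ _)]
    rfl
  · exact (continuous_convAvg_gauss hτ).measurable.ennreal_ofReal

theorem score_add_gauss (hτ : τ ≠ 0) (hS : AEMeasurable S P)
    (hZ : HasLaw Z (gaussianReal 0 τ) P) (hSZ : IndepFun S Z P) :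
    score P (S + Z) = fun x => convAvg (gaussDeriv τ) (P.map S) x
      / convAvg (gaussianPDFReal 0 τ) (P.map S) x := by
  have : IsProbabilityMeasure (P.map S) := Measure.isProbabilityMeasure_map hS
  ext x
  rw [score, (isC1Density_add_gauss hτ hS hZ hSZ).density_eq, (hasDerivAt_convAvg_gauss hτ x).deriv]

theorem continuous_score_add_gauss (hτ : τ ≠ 0) (hS : AEMeasurable S P)
    (hZ : HasLaw Z (gaussianReal 0 τ) P) (hSZ : IndepFun S Z P) :
    Continuous (score P (S + Z)) := by
  have : IsProbabilityMeasure (P.map S) := Measure.isProbabilityMeasure_map hS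
  rw [score_add_gauss hτ hS hZ hSZ]
  exact (continuous_convAvg_gaussDeriv hτ).div (continuous_convAvg_gauss hτ)
    fun x => (convAvg_gauss_pos hτ x).ne'

/-- Expectations over `(S + Z, Z)` as iterated integrals against the Gaussian density. -/
theorem integral_add_gauss (hτ : τ ≠ 0) (hS : AEMeasurable S P)
    (hZ : HasLaw Z (gaussianReal 0 τ) P) (hSZ : IndepFun S Z P) {F : ℝ → ℝ → ℝ}
    (hF : Measurable (Function.uncurry F))
    (hi : Integrable (fun ω => F ((S + Z) ω) (Z ω)) P) :
    Integrable (fun x => ∫ s, gaussianPDFReal 0 τ (x - s) * F x (x - s) ∂(P.map S)) ∧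
    ∫ ω, F ((S + Z) ω) (Z ω) ∂P
      = ∫ x, ∫ s, gaussianPDFReal 0 τ (x - s) * F x (x - s) ∂(P.map S) := by
  have hZm := hZ.aemeasurable
  have : IsProbabilityMeasure (P.map S) := Measure.isProbabilityMeasure_map hS
  have hgm := measurable_gaussianPDFReal 0 τ
  let G : ℝ × ℝ → ℝ := fun p => F p.1 (p.1 - p.2)
  have hG : Measurable G := by
    have : Measurable (fun p : ℝ × ℝ => (p.1, p.1 - p.2)) := by fun_prop
    exact hF.comp this
  have e : (fun ω => F ((S + Z) ω) (Z ω)) = fun ω => G ((S + Z) ω, S ω) := by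
    ext ω; simp [G]
  have hpm : AEMeasurable (fun ω => ((S + Z) ω, S ω)) P := by fun_prop
  have hm : Measurable (fun p : ℝ × ℝ => (gaussianPDFReal 0 τ (p.1 - p.2)).toNNReal) := by
    fun_prop
  rw [e] at hi ⊢
  have hi' : Integrable G (P.map (fun ω => ((S + Z) ω, S ω))) :=
    (integrable_map_measure hG.aestronglyMeasurable hpm).2 hi
  rw [map_add_gauss_prod hτ hS hZ hSZ, integrable_withDensity_iff_integrable_smul hm] at hi'
  rw [← integral_map (f := G) hpm hG.aestronglyMeasurable, map_add_gauss_prod hτ hS hZ hSZ,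
    integral_withDensity_eq_integral_smul hm, integral_prod _ hi']
  have e2 : ∀ x s, (gaussianPDFReal 0 τ (x - s)).toNNReal • G (x, s)
      = gaussianPDFReal 0 τ (x - s) * F x (x - s) := fun x s => by
    rw [NNReal.smul_def, Real.coe_toNNReal _ (gaussianPDFReal_nonneg _ _ _), smul_eq_mul]
  have h3 := hi'.integral_prod_left
  simp only [e2] at h3 ⊢
  exact ⟨h3, trivial⟩

theorem integral_comp_add_gauss (hτ : τ ≠ 0) (hS : AEMeasurable S P)
    (hZ : HasLaw Z (gaussianReal 0 τ) P) (hSZ : IndepFun S Z P) {h : ℝ → ℝ}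
    (hh : Measurable h) :
    ∫ ω, h ((S + Z) ω) ∂P = ∫ x, convAvg (gaussianPDFReal 0 τ) (P.map S) x * h x := by
  have : IsProbabilityMeasure (P.map S) := Measure.isProbabilityMeasure_map hS
  have hd := isC1Density_add_gauss hτ hS hZ hSZ
  have hm : Measurable (fun x => (convAvg (gaussianPDFReal 0 τ) (P.map S) x).toNNReal) :=
    (continuous_convAvg_gauss hτ).measurable.real_toNNReal
  rw [← integral_map (f := h) hd.aemeasurable hh.aestronglyMeasurable, hd.map_eq]
  change ∫ x, h x ∂(volume.withDensity fun x =>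
    ((convAvg (gaussianPDFReal 0 τ) (P.map S) x).toNNReal : ENNReal)) = _
  rw [integral_withDensity_eq_integral_smul hm]
  refine integral_congr_ae (ae_of_all _ fun x => ?_)
  change _ • _ = _
  rw [NNReal.smul_def, Real.coe_toNNReal _ (convAvg_gauss_nonneg _), smul_eq_mul]

theorem integrable_comp_add_gauss (hτ : τ ≠ 0) (hS : AEMeasurable S P)
    (hZ : HasLaw Z (gaussianReal 0 τ) P) (hSZ : IndepFun S Z P) {h : ℝ → ℝ}
    (hh : Measurable h) :
    Integrable (fun ω => h ((S + Z) ω)) P ↔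
      Integrable (fun x => convAvg (gaussianPDFReal 0 τ) (P.map S) x * h x) := by
  have : IsProbabilityMeasure (P.map S) := Measure.isProbabilityMeasure_map hS
  have hd := isC1Density_add_gauss hτ hS hZ hSZ
  have hm : Measurable (fun x => (convAvg (gaussianPDFReal 0 τ) (P.map S) x).toNNReal) :=
    (continuous_convAvg_gauss hτ).measurable.real_toNNReal
  have h1 := integrable_map_measure (μ := P) (f := S + Z) (g := h) hh.aestronglyMeasurable
    hd.aemeasurable
  refine h1.symm.trans ?_
  rw [hd.map_eq]
  change Integrable h (volume.withDensity fun x =>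
    ((convAvg (gaussianPDFReal 0 τ) (P.map S) x).toNNReal : ENNReal)) ↔ _
  rw [integrable_withDensity_iff_integrable_smul hm]
  refine integrable_congr (ae_of_all _ fun x => ?_)
  change _ • _ = _
  rw [NNReal.smul_def, Real.coe_toNNReal _ (convAvg_gauss_nonneg _), smul_eq_mul]

/-- Conditional expectation formula for the score: `E[h(X) ρ_X(X)] = -E[h(X) Z] / τ`. -/
theorem integral_mul_score_add_gauss (hτ : τ ≠ 0) (hS : AEMeasurable S P)
    (hZ : HasLaw Z (gaussianReal 0 τ) P) (hSZ : IndepFun S Z P) {h : ℝ → ℝ}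
    (hh : Measurable h) (hi : Integrable (fun ω => h ((S + Z) ω) * Z ω) P) :
    ∫ ω, h ((S + Z) ω) * score P (S + Z) ((S + Z) ω) ∂P
      = -(∫ ω, h ((S + Z) ω) * Z ω ∂P) / τ := by
  have : IsProbabilityMeasure (P.map S) := Measure.isProbabilityMeasure_map hS
  have hc := continuous_score_add_gauss hτ hS hZ hSZ
  rw [integral_comp_add_gauss hτ hS hZ hSZ (h := fun x => h x * score P (S + Z) x)
    (hh.mul hc.measurable), (integral_add_gauss hτ hS hZ hSZ (F := fun x z => h x * z)
    (by unfold Function.uncurry; fun_prop) hi).2, neg_div, ← integral_div, ← integral_neg]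
  refine integral_congr_ae (ae_of_all _ fun x => ?_)
  have hp := (convAvg_gauss_pos (μ := P.map S) hτ x).ne'
  have e1 : convAvg (gaussianPDFReal 0 τ) (P.map S) x * (h x * score P (S + Z) x)
      = h x * convAvg (gaussDeriv τ) (P.map S) x := by
    rw [score_add_gauss hτ hS hZ hSZ]; field_simp
  change convAvg (gaussianPDFReal 0 τ) (P.map S) x * (h x * score P (S + Z) x) = _
  beta_reduce
  rw [e1, convAvg, ← integral_const_mul, ← integral_div, ← integral_neg]
  refine integral_congr_ae (ae_of_all _ fun s => ?_)
  simp only [gaussDeriv]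
  ring

/-- The squared score restricted to an event on `X` is dominated by the second moment of the
noise on that event. -/
theorem integral_indicator_score_sq_le (hτ : τ ≠ 0) (hS : AEMeasurable S P)
    (hZ : HasLaw Z (gaussianReal 0 τ) P) (hSZ : IndepFun S Z P)
    {h : ℝ → ℝ} (hh : Measurable h) (h0 : ∀ x, 0 ≤ h x)
    (hi : Integrable (fun ω => h ((S + Z) ω) * (Z ω / τ) ^ 2) P) :
    Integrable (fun ω => h ((S + Z) ω) * score P (S + Z) ((S + Z) ω) ^ 2) P ∧
    ∫ ω, h ((S + Z) ω) * score P (S + Z) ((S + Z) ω) ^ 2 ∂P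
      ≤ ∫ ω, h ((S + Z) ω) * (Z ω / τ) ^ 2 ∂P := by
  have : IsProbabilityMeasure (P.map S) := Measure.isProbabilityMeasure_map hS
  have hc := (continuous_score_add_gauss hτ hS hZ hSZ).measurable
  have hm : Measurable (fun x => h x * score P (S + Z) x ^ 2) := hh.mul (hc.pow_const 2)
  obtain ⟨j1, j2⟩ := integral_add_gauss hτ hS hZ hSZ (F := fun x z => h x * (z / τ) ^ 2)
    (by unfold Function.uncurry; fun_prop) hi
  have hle : ∀ x, convAvg (gaussianPDFReal 0 τ) (P.map S) x * (h x * score P (S + Z) x ^ 2)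
      ≤ ∫ s, gaussianPDFReal 0 τ (x - s) * (h x * ((x - s) / τ) ^ 2) ∂(P.map S) := by
    intro x
    have h1 := mul_le_mul_of_nonneg_left (sq_score_mul_le (μ := P.map S) hτ x) (h0 x)
    have e : h x * convAvg (fun z => (z / τ) ^ 2 * gaussianPDFReal 0 τ z) (P.map S) x
        = ∫ s, gaussianPDFReal 0 τ (x - s) * (h x * ((x - s) / τ) ^ 2) ∂(P.map S) := by
      rw [convAvg, ← integral_const_mul]
      congr 1
      ext s
      ring
    rw [e] at h1
    rw [score_add_gauss hτ hS hZ hSZ]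
    linarith
  have hn : ∀ x, 0 ≤ convAvg (gaussianPDFReal 0 τ) (P.map S) x * (h x * score P (S + Z) x ^ 2) :=
    fun x => mul_nonneg (convAvg_gauss_nonneg x) (mul_nonneg (h0 x) (sq_nonneg _))
  have hint : Integrable (fun x => convAvg (gaussianPDFReal 0 τ) (P.map S) x
      * (h x * score P (S + Z) x ^ 2)) := by
    refine j1.mono' ?_ (ae_of_all _ fun x => ?_)
    · exact ((continuous_convAvg_gauss hτ).measurable.mul hm).aestronglyMeasurable
    · rw [Real.norm_eq_abs, abs_of_nonneg (hn x)]
      exact hle x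
  refine ⟨(integrable_comp_add_gauss hτ hS hZ hSZ hm).2 hint, ?_⟩
  rw [integral_comp_add_gauss hτ hS hZ hSZ hm, j2]
  exact integral_mono hint j1 hle

end noise

/-! ### Locally uniform bounds from tightness -/

theorem gaussianPDFReal_le_of_abs_le (τ : ℝ≥0) {x y : ℝ} (h : |x| ≤ y) :
    gaussianPDFReal 0 τ y ≤ gaussianPDFReal 0 τ x := by
  have h2 : x ^ 2 ≤ y ^ 2 := sq_le_sq' (by linarith [(abs_le.1 h).1]) (abs_le.1 h).2
  rw [gaussianPDFReal_def]
  beta_reduce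
  rw [sub_zero, sub_zero]
  gcongr

/-- At least half of the mass lies within distance `R + M` of `x`, where the kernel is at least its
value at `R + M`. The bound depends on the law only through `M`. -/
theorem le_convAvg_gauss {τ : ℝ≥0} (hτ : τ ≠ 0) {μ : Measure ℝ} [IsProbabilityMeasure μ]
    {M R x : ℝ} (hμ : 1 / 2 ≤ μ.real {s | |s| ≤ M}) (hx : |x| ≤ R) :
    1 / 2 * gaussianPDFReal 0 τ (R + M) ≤ convAvg (gaussianPDFReal 0 τ) μ x := by
  obtain ⟨C, -, hC⟩ := exists_gauss_bound hτ
  have hA : MeasurableSet {s : ℝ | |s| ≤ M} := measurableSet_le (by fun_prop) (by fun_prop)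
  have hi := integrable_comp_sub (μ := μ) (continuous_gaussianPDFReal_zero hτ)
    (fun x => (hC x).1) x
  have hg := gaussianPDFReal_nonneg 0 τ (R + M)
  calc 1 / 2 * gaussianPDFReal 0 τ (R + M)
      ≤ μ.real {s | |s| ≤ M} * gaussianPDFReal 0 τ (R + M) := by gcongr
    _ = ∫ _ in {s | |s| ≤ M}, gaussianPDFReal 0 τ (R + M) ∂μ := by
        rw [setIntegral_const, smul_eq_mul]
    _ ≤ ∫ s in {s | |s| ≤ M}, gaussianPDFReal 0 τ (x - s) ∂μ := by
        refine setIntegral_mono_on (integrable_const _).integrableOn hi.integrableOn hA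
          fun s hs => gaussianPDFReal_le_of_abs_le τ ?_
        exact (abs_sub x s).trans (add_le_add hx hs)
    _ ≤ _ := setIntegral_le_integral hi (ae_of_all _ fun s => gaussianPDFReal_nonneg 0 τ _)

/-- Locally uniform bound and Lipschitz constant of the score of a Gaussian convolution. -/
theorem exists_score_bound {τ : ℝ≥0} (hτ : τ ≠ 0) (M R : ℝ) :
    ∃ L, 0 < L ∧ ∀ (μ : Measure ℝ) [IsProbabilityMeasure μ], 1 / 2 ≤ μ.real {s | |s| ≤ M} →
      (∀ x, |x| ≤ R → |convAvg (gaussDeriv τ) μ x / convAvg (gaussianPDFReal 0 τ) μ x| ≤ L) ∧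
      ∀ x y, |x| ≤ R → |y| ≤ R →
        |convAvg (gaussDeriv τ) μ x / convAvg (gaussianPDFReal 0 τ) μ x
          - convAvg (gaussDeriv τ) μ y / convAvg (gaussianPDFReal 0 τ) μ y| ≤ L * |x - y| := by
  obtain ⟨C, hC0, hC⟩ := exists_gauss_bound hτ
  set c := 1 / 2 * gaussianPDFReal 0 τ (R + M) with hc
  have hc0 : 0 < c := by
    have := gaussianPDFReal_pos 0 τ (R + M) hτ
    positivity
  -- The first summand bounds `p'/p`; the second bounds its derivative `(p'' p - p'²)/p²`.
  refine ⟨C / c + (C * C + C * C) / c ^ 2, by positivity, fun μ _ hμ => ?_⟩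
  have hle : ∀ x, |x| ≤ R → c ≤ convAvg (gaussianPDFReal 0 τ) μ x := fun x hx =>
    le_convAvg_gauss hτ hμ hx
  have b0 := abs_convAvg_le (μ := μ) fun x => (hC x).1
  have b1 := abs_convAvg_le (μ := μ) fun x => (hC x).2.1
  have b2 := abs_convAvg_le (μ := μ) fun x => (hC x).2.2.1
  constructor
  · intro x hx
    have hp := convAvg_gauss_pos (μ := μ) hτ x
    have : |convAvg (gaussDeriv τ) μ x / convAvg (gaussianPDFReal 0 τ) μ x| ≤ C / c := by
      rw [abs_div, abs_of_pos hp]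
      exact div_le_div₀ hC0.le (b1 x) hc0 (hle x hx)
    have : 0 ≤ (C * C + C * C) / c ^ 2 := by positivity
    linarith
  · intro x y hx hy
    have hd : ∀ z ∈ Set.Icc (-R) R, HasDerivWithinAt
        (fun x => convAvg (gaussDeriv τ) μ x / convAvg (gaussianPDFReal 0 τ) μ x)
        ((convAvg (gaussDeriv2 τ) μ z * convAvg (gaussianPDFReal 0 τ) μ z
          - convAvg (gaussDeriv τ) μ z * convAvg (gaussDeriv τ) μ z)
          / convAvg (gaussianPDFReal 0 τ) μ z ^ 2) (Set.Icc (-R) R) z := fun z _ =>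
      ((hasDerivAt_convAvg_gaussDeriv hτ z).fun_div (hasDerivAt_convAvg_gauss hτ z)
        (convAvg_gauss_pos hτ z).ne').hasDerivWithinAt
    refine (convex_Icc (-R) R).norm_image_sub_le_of_norm_hasDerivWithin_le hd (fun z hz => ?_)
      (abs_le.1 hy) (abs_le.1 hx)
    have hp := convAvg_gauss_pos (μ := μ) hτ z
    have h1 : |(convAvg (gaussDeriv2 τ) μ z * convAvg (gaussianPDFReal 0 τ) μ z
          - convAvg (gaussDeriv τ) μ z * convAvg (gaussDeriv τ) μ z)
          / convAvg (gaussianPDFReal 0 τ) μ z ^ 2| ≤ (C * C + C * C) / c ^ 2 := by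
      rw [abs_div, abs_of_pos (pow_pos hp 2)]
      refine div_le_div₀ (by positivity) ((abs_sub _ _).trans ?_) (pow_pos hc0 2) ?_
      · rw [abs_mul, abs_mul]
        exact add_le_add (mul_le_mul (b2 z) (b0 z) (abs_nonneg _) hC0.le)
          (mul_le_mul (b1 z) (b1 z) (abs_nonneg _) hC0.le)
      · exact pow_le_pow_left₀ hc0.le (hle z (abs_le.2 hz)) 2
    have : 0 ≤ C / c := by positivity
    rw [Real.norm_eq_abs]
    linarith

/-- The event is an interval of length `2r` contained in `[-(R+1+M), R+1+M]`, on which the Gaussian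
density is at least its value at the endpoint. -/
theorem le_gaussianReal_abs_add_sub_le {τ : ℝ≥0} (hτ : τ ≠ 0) {M R r s x : ℝ}
    (hr1 : r ≤ 1) (hs : |s| ≤ M) (hx : |x| ≤ R) :
    ENNReal.ofReal (2 * r * gaussianPDFReal 0 τ (R + 1 + M))
      ≤ gaussianReal 0 τ {z | |s + z - x| ≤ r} := by
  have e : {z : ℝ | |s + z - x| ≤ r} = Set.Icc (x - s - r) (x - s + r) := by
    ext z
    simp only [Set.mem_ofPred_eq, Set.mem_Icc, abs_le]
    constructor <;> rintro ⟨h1, h2⟩ <;> constructor <;> linarith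
  rw [e, gaussianReal_apply 0 hτ]
  calc ENNReal.ofReal (2 * r * gaussianPDFReal 0 τ (R + 1 + M))
      = ∫⁻ _ in Set.Icc (x - s - r) (x - s + r), gaussianPDF 0 τ (R + 1 + M) := by
        rw [setLIntegral_const, Real.volume_Icc, gaussianPDF,
          ← ENNReal.ofReal_mul (gaussianPDFReal_nonneg _ _ _)]
        congr 1
        ring
    _ ≤ _ := by
        refine setLIntegral_mono (measurable_gaussianPDF 0 τ) fun z hz => ?_
        refine ENNReal.ofReal_le_ofReal (gaussianPDFReal_le_of_abs_le τ ?_)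
        obtain ⟨h1, h2⟩ := abs_le.1 hs
        obtain ⟨h3, h4⟩ := abs_le.1 hx
        exact abs_le.2 ⟨by linarith [hz.1], by linarith [hz.2]⟩

/-! ### From a small mean square to a uniform bound on a box -/

section noise

variable {Ω : Type*} [MeasurableSpace Ω] {P : Measure Ω} [IsProbabilityMeasure P]
  {τ : ℝ≥0} {S T ZS ZT : Ω → ℝ}

/-- Small squares have probability bounded below, locally uniformly. -/
theorem le_measureReal_square (hτ : τ ≠ 0) (hS : AEMeasurable S P) (hT : AEMeasurable T P)
    (hZS : HasLaw ZS (gaussianReal 0 τ) P) (hZT : HasLaw ZT (gaussianReal 0 τ) P)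
    (hST : IndepFun (fun ω => (S ω, T ω)) (fun ω => (ZS ω, ZT ω)) P) (hZ : IndepFun ZS ZT P)
    {M R r x y : ℝ} (hM : 1 / 2 ≤ P.real {ω | |S ω| ≤ M ∧ |T ω| ≤ M})
    (hr : 0 ≤ r) (hr1 : r ≤ 1) (hx : |x| ≤ R) (hy : |y| ≤ R) :
    2 * gaussianPDFReal 0 τ (R + 1 + M) ^ 2 * r ^ 2
      ≤ P.real {ω | |(S + ZS) ω - x| ≤ r ∧ |(T + ZT) ω - y| ≤ r} := by
  have hZSm := hZS.aemeasurable
  have hZTm := hZT.aemeasurable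
  set m := gaussianPDFReal 0 τ (R + 1 + M) with hm
  have hm0 : 0 ≤ m := gaussianPDFReal_nonneg _ _ _
  have hSTm : AEMeasurable (fun ω => (S ω, T ω)) P := by fun_prop
  have hZm : AEMeasurable (fun ω => (ZS ω, ZT ω)) P := by fun_prop
  have : IsProbabilityMeasure (P.map fun ω => (S ω, T ω)) := Measure.isProbabilityMeasure_map hSTm
  have l1 := (indepFun_iff_map_prod_eq_prod_map_map hSTm hZm).1 hST
  have l2 := (indepFun_iff_map_prod_eq_prod_map_map hZSm hZTm).1 hZ
  rw [l2, hZS.map_eq, hZT.map_eq] at l1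
  let E : Set ((ℝ × ℝ) × ℝ × ℝ) := 
    {q | |q.1.1 + q.2.1 - x| ≤ r} ∩ {q | |q.1.2 + q.2.2 - y| ≤ r}
  have hE : MeasurableSet E := (measurableSet_le (by fun_prop) (by fun_prop)).inter
    (measurableSet_le (by fun_prop) (by fun_prop))
  let A : Set (ℝ × ℝ) := {p | |p.1| ≤ M} ∩ {p | |p.2| ≤ M}
  have hA : MeasurableSet A := (measurableSet_le (by fun_prop) (by fun_prop)).inter
    (measurableSet_le (by fun_prop) (by fun_prop))
  have eE : P {ω | |(S + ZS) ω - x| ≤ r ∧ |(T + ZT) ω - y| ≤ r}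
      = ((P.map fun ω => (S ω, T ω)).prod ((gaussianReal 0 τ).prod (gaussianReal 0 τ))) E := by
    rw [← l1, Measure.map_apply_of_aemeasurable (by fun_prop) hE]
    rfl
  have eA : P {ω | |S ω| ≤ M ∧ |T ω| ≤ M} = (P.map fun ω => (S ω, T ω)) A := by
    rw [Measure.map_apply_of_aemeasurable (by fun_prop) hA]
    rfl
  -- Conditionally on `(S,T)` in the box `[-M,M]²`, the two noises fall independently into the
  -- required intervals; that box has probability at least `1/2`.
  have key : ENNReal.ofReal (2 * r * m) * ENNReal.ofReal (2 * r * m)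
      * P {ω | |S ω| ≤ M ∧ |T ω| ≤ M}
      ≤ P {ω | |(S + ZS) ω - x| ≤ r ∧ |(T + ZT) ω - y| ≤ r} := by
    rw [eE, eA, Measure.prod_apply hE, ← setLIntegral_const]
    refine le_trans (setLIntegral_mono (measurable_measure_prodMk_left hE) fun p hp => ?_)
      (setLIntegral_le_lintegral A _)
    have e : Prod.mk p ⁻¹' E = {z | |p.1 + z - x| ≤ r} ×ˢ {w | |p.2 + w - y| ≤ r} := rfl
    rw [e, Measure.prod_prod]
    exact mul_le_mul' (le_gaussianReal_abs_add_sub_le hτ hr1 hp.1 hx)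
      (le_gaussianReal_abs_add_sub_le hτ hr1 hp.2 hy)
  have k2 := ENNReal.toReal_mono (measure_ne_top _ _) key
  rw [ENNReal.toReal_mul, ENNReal.toReal_mul, ENNReal.toReal_ofReal (by positivity)] at k2
  change 2 * r * m * (2 * r * m) * P.real {ω | |S ω| ≤ M ∧ |T ω| ≤ M} ≤ P.real _ at k2
  refine le_trans ?_ k2
  have : 0 ≤ 2 * r * m * (2 * r * m) := by positivity
  nlinarith

/-- A Lipschitz function of `(X, Y)` with small second moment is locally uniformly small when
small squares are charged by the law of `(X, Y)`. -/
theorem exists_forall_abs_le_of_integral_sq_lt {L c R η : ℝ} (hL : 0 < L) (hc : 0 < c)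
    (hη : 0 < η) :
    ∃ ε, 0 < ε ∧ ∀ {Ω : Type*} [MeasurableSpace Ω] (P : Measure Ω) [IsProbabilityMeasure P]
      (X Y : Ω → ℝ) (D : ℝ → ℝ → ℝ),
      (∀ x y x' y', |x| ≤ R → |y| ≤ R → |x' - x| ≤ 1 → |y' - y| ≤ 1 →
        |D x' y' - D x y| ≤ L * (|x' - x| + |y' - y|)) →
      (∀ r x y, 0 ≤ r → r ≤ 1 → |x| ≤ R → |y| ≤ R →
        c * r ^ 2 ≤ P.real {ω | |X ω - x| ≤ r ∧ |Y ω - y| ≤ r}) →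
      Integrable (fun ω => D (X ω) (Y ω) ^ 2) P → ∫ ω, D (X ω) (Y ω) ^ 2 ∂P < ε →
      ∀ x y, |x| ≤ R → |y| ≤ R → |D x y| ≤ η := by
  -- On a square of half-side `r` the function varies by at most `2Lr ≤ η/2`, so `|D| > η` at the
  -- centre forces `|D| ≥ η/2` throughout. Markov's inequality then contradicts the bound `(η/2)² ·
  -- c r²`.
  set r := min 1 (η / (4 * L)) with hr
  have hr0 : 0 < r := lt_min one_pos (by positivity)
  have hr1 : r ≤ 1 := min_le_left _ _
  have hrL : L * (r + r) ≤ η / 2 := by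
    have h1 : r ≤ η / (4 * L) := min_le_right _ _
    rw [le_div_iff₀ (by positivity)] at h1
    linarith
  refine ⟨(η / 2) ^ 2 * (c * r ^ 2), by positivity, ?_⟩
  intro Ω _ P _ X Y D hlip hsq hint hlt x y hx hy
  by_contra! hcon
  have hsub : {ω | |X ω - x| ≤ r ∧ |Y ω - y| ≤ r} ⊆ {ω | (η / 2) ^ 2 ≤ D (X ω) (Y ω) ^ 2} := by
    rintro ω ⟨h1, h2⟩
    have h3 := hlip x y (X ω) (Y ω) hx hy (h1.trans hr1) (h2.trans hr1)
    have h4 : |D (X ω) (Y ω) - D x y| ≤ η / 2 :=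
      h3.trans ((mul_le_mul_of_nonneg_left (add_le_add h1 h2) hL.le).trans hrL)
    have h5 : η / 2 ≤ |D (X ω) (Y ω)| := by
      have := abs_sub_abs_le_abs_sub (D x y) (D (X ω) (Y ω))
      rw [abs_sub_comm] at this
      linarith
    change (η / 2) ^ 2 ≤ D (X ω) (Y ω) ^ 2
    rw [← sq_abs (D (X ω) (Y ω))]
    exact pow_le_pow_left₀ (by positivity) h5 2
  have hmk := mul_meas_ge_le_integral_of_nonneg (ae_of_all _ fun ω => sq_nonneg (D (X ω) (Y ω)))
    hint ((η / 2) ^ 2)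
  have h6 := (hsq r x y hr0.le hr1 hx hy).trans (measureReal_mono hsub)
  have h7 : (η / 2) ^ 2 * (c * r ^ 2)
      ≤ (η / 2) ^ 2 * P.real {ω | (η / 2) ^ 2 ≤ D (X ω) (Y ω) ^ 2} := by gcongr
  linarith

end noise

/-! ### The normalised sum as a noisy variable -/

theorem hasLaw_mix {Ω : Type*} [MeasurableSpace Ω] {P : Measure Ω} {τ : ℝ≥0} {ZS ZT : Ω → ℝ}
    (hZS : HasLaw ZS (gaussianReal 0 τ) P)
    (hZT : HasLaw ZT (gaussianReal 0 τ) P)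
    (hZ : IndepFun ZS ZT P) {β : ℝ} (h0 : 0 ≤ β) (h1 : β ≤ 1) :
    HasLaw (mix β ZS ZT) (gaussianReal 0 τ) P := by
  have i := hZ.comp (φ := fun x => √β * x) (ψ := fun x => √(1 - β) * x) (by fun_prop) (by fun_prop)
  have h := i.hasLaw_fun_add (gaussianReal_const_mul hZS √β) (gaussianReal_const_mul hZT √(1 - β))
  rw [gaussianReal_conv_gaussianReal] at h
  have e : (NNReal.mk (√β ^ 2) (sq_nonneg _) * τ + NNReal.mk (√(1 - β) ^ 2) (sq_nonneg _) * τ)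
      = τ := by
    ext
    rw [NNReal.coe_add, NNReal.coe_mul, NNReal.coe_mul, NNReal.coe_mk, NNReal.coe_mk,
      Real.sq_sqrt h0, Real.sq_sqrt (by linarith)]
    ring
  rw [e] at h
  simp only [mul_zero, add_zero] at h
  exact h

theorem indepFun_mix {Ω : Type*} [MeasurableSpace Ω] {P : Measure Ω} {S T ZS ZT : Ω → ℝ}
    (hST : IndepFun (fun ω => (S ω, T ω)) (fun ω => (ZS ω, ZT ω)) P) (β : ℝ) :
    IndepFun (mix β S T) (mix β ZS ZT) P :=
  hST.comp (φ := fun p : ℝ × ℝ => √β * p.1 + √(1 - β) * p.2)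
    (ψ := fun p : ℝ × ℝ => √β * p.1 + √(1 - β) * p.2) (by fun_prop) (by fun_prop)

/-- This splitting into signal and noise lets every result on the score of `S + Z` apply to the
normalised sum as well. -/
theorem mix_add {Ω : Type*} (β : ℝ) (S T ZS ZT : Ω → ℝ) :
    mix β (S + ZS) (T + ZT) = mix β S T + mix β ZS ZT := by
  ext ω
  simp only [mix, Pi.add_apply]
  ring

/-! ### Approximate functional equations -/

/-- Stability of the additive Cauchy equation on an interval. -/
theorem abs_sub_linear_le_of_approx_additive {F : ℝ → ℝ} {R η : ℝ} (hR : 0 < R)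
    (hF : ContinuousOn F (Set.Icc (-R) R))
    (hadd : ∀ x y, |x| ≤ R → |y| ≤ R → |x + y| ≤ R → |F (x + y) - F x - F y| ≤ η)
    {x : ℝ} (hx : |x| ≤ R) : |F x - F R / R * x| ≤ 3 * η := by
  -- Subtracting the chord keeps the additivity defect and makes the error vanish at `R`, so a shift
  -- by `R` costs only `η`.
  let E : ℝ → ℝ := fun x => F x - F R / R * x
  have hE : ContinuousOn E (Set.Icc (-R) R) := hF.sub (by fun_prop)
  have hER : E R = 0 := by simp only [E]; field_simp; ring
  have hEadd : ∀ x y, |x| ≤ R → |y| ≤ R → |x + y| ≤ R → |E (x + y) - E x - E y| ≤ η := by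
    intro x y h1 h2 h3
    have e : E (x + y) - E x - E y = F (x + y) - F x - F y := by simp only [E]; ring
    rw [e]; exact hadd x y h1 h2 h3
  obtain ⟨z, hz, hmax⟩ := (isCompact_Icc (a := -R) (b := R)).exists_isMaxOn
    ⟨0, by constructor <;> linarith⟩ hE.abs
  have hb : ∀ w, |w| ≤ R → |E w| ≤ |E z| := fun w hw => hmax (abs_le.1 hw)
  -- On the inner half, doubling halves the error. A maximiser in the outer half is shifted by `±R`
  -- into the inner half, which gives `|E z| ≤ (|E z| + η)/2 + η` and hence `3η`.
  have half : ∀ w, |w| ≤ R / 2 → 2 * |E w| ≤ |E z| + η := by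
    intro w hw
    have hw' : |w| ≤ R := by linarith
    have h2 : |w + w| ≤ R := by rw [← two_mul, abs_mul, abs_two]; linarith
    have h3 := hEadd w w hw' hw' h2
    have h4 := hb _ h2
    have h5 : |2 * E w| ≤ |E (w + w)| + |E (w + w) - E w - E w| := by
      have := abs_sub (E (w + w)) (E (w + w) - E w - E w)
      have e : E (w + w) - (E (w + w) - E w - E w) = 2 * E w := by ring
      rwa [e] at this
    rw [abs_mul, abs_two] at h5
    linarith
  have hz' := abs_le.2 hz
  suffices |E z| ≤ 3 * η from (hb x hx).trans this
  have hη : 0 ≤ η := (abs_nonneg _).trans (hEadd 0 0 (by simpa using hR.le) (by simpa using hR.le)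
    (by simpa using hR.le))
  have hRR : |R| ≤ R := (abs_of_pos hR).le
  rcases le_or_gt |z| (R / 2) with hc | hc
  · linarith [half z hc]
  · rcases le_or_gt 0 z with h0 | h0
    · rw [abs_of_nonneg h0] at hc hz'
      have hw : |z - R| ≤ R / 2 := by rw [abs_le]; constructor <;> linarith
      have h1 := hEadd (z - R) R (by linarith) hRR (by
        rw [sub_add_cancel, abs_of_nonneg h0]; exact hz')
      rw [sub_add_cancel, hER, sub_zero] at h1
      have h2 := abs_sub_abs_le_abs_sub (E z) (E (z - R))
      linarith [half _ hw]
    · rw [abs_of_neg h0] at hc hz'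
      have hw : |z + R| ≤ R / 2 := by rw [abs_le]; constructor <;> linarith
      have h1 := hEadd z R (by rw [abs_of_neg h0]; exact hz') hRR (by linarith)
      rw [hER, sub_zero, abs_sub_comm] at h1
      have h2 := abs_sub_abs_le_abs_sub (E z) (E (z + R))
      linarith [half _ hw]

/-- If `a f(x) + b g(y)` is nearly a function of `a x + b y`, then `f` is nearly affine. -/
theorem exists_affine_approx {f g k : ℝ → ℝ} {a b κ R η : ℝ} (hκ : 0 < κ) (hκa : κ ≤ a) (ha : a ≤ 1)
    (hκb : κ ≤ b) (hR : 0 < R) (hf : Continuous f)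
    (hD : ∀ x y, |x| ≤ R / κ → |y| ≤ R / κ → |a * f x + b * g y - k (a * x + b * y)| ≤ η) :
    ∃ B, ∀ x, |x| ≤ R → |f x - f 0 - B * x| ≤ 12 * η / κ := by
  have ha0 : 0 < a := hκ.trans_le hκa
  have hb0 : 0 < b := hκ.trans_le hκb
  have hRκ : R ≤ R / κ := by rw [le_div_iff₀ hκ]; nlinarith
  let F : ℝ → ℝ := fun x => a * (f x - f 0)
  have hη : 0 ≤ η := (abs_nonneg _).trans (hD 0 0 (by simp; positivity) (by simp; positivity))
  have hadd : ∀ x y, |x| ≤ R → |y| ≤ R → |x + y| ≤ R → |F (x + y) - F x - F y| ≤ 4 * η := by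
    intro x y hx hy hxy
    -- With `b w = a y`, the defects at `(x+y,0)`, `(x,w)`, `(y,0)`, `(0,w)` combine with signs
    -- `+,-,-,+` so that `g` and `k` cancel. The box of radius `R/κ` is there to contain `w`.
    set w := a * y / b with hw
    have hbw : b * w = a * y := by rw [hw]; field_simp
    have hwR : |w| ≤ R / κ := by
      rw [hw, abs_div, abs_mul, abs_of_pos ha0, abs_of_pos hb0]
      exact div_le_div₀ hR.le (by nlinarith [abs_nonneg y]) hκ hκb
    have h0 : |(0 : ℝ)| ≤ R / κ := by simp; positivity
    have d1 := abs_le.1 (hD (x + y) 0 (by linarith) h0)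
    have d2 := abs_le.1 (hD x w (by linarith) hwR)
    have d3 := abs_le.1 (hD y 0 (by linarith) h0)
    have d4 := abs_le.1 (hD 0 w h0 hwR)
    rw [hbw, ← mul_add] at d2
    rw [hbw, mul_zero, zero_add] at d4
    rw [mul_zero, add_zero] at d1 d3
    simp only [F]
    rw [abs_le]
    constructor <;> linarith [d1.1, d1.2, d2.1, d2.2, d3.1, d3.2, d4.1, d4.2]
  refine ⟨F R / R / a, fun x hx => ?_⟩
  have h := abs_sub_linear_le_of_approx_additive hR (F := F)
    (by simp only [F]; fun_prop) hadd hx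
  have e : f x - f 0 - F R / R / a * x = (F x - F R / R * x) / a := by
    simp only [F]; field_simp
  rw [e, abs_div, abs_of_pos ha0]
  refine div_le_div₀ (by positivity) (by linarith) hκ hκa

/-! ### Moments of the noise and of the score -/

theorem memLp_of_hasLaw_gauss {Ω : Type*} [MeasurableSpace Ω] {P : Measure Ω} {τ : ℝ≥0} {Z : Ω → ℝ}
    (hZ : HasLaw Z (gaussianReal 0 τ) P) (p : ℝ≥0) : MemLp Z p P := by
  have := memLp_id_gaussianReal (μ := 0) (v := τ) p
  rw [← hZ.map_eq] at this
  exact (memLp_map_measure_iff this.1 hZ.aemeasurable).1 this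

theorem integral_of_hasLaw_gauss {Ω : Type*} [MeasurableSpace Ω] {P : Measure Ω} {τ : ℝ≥0}
    {Z : Ω → ℝ} (hZ : HasLaw Z (gaussianReal 0 τ) P) : ∫ ω, Z ω ∂P = 0 := by
  rw [← integral_id_gaussianReal (μ := 0) (v := τ)]
  exact hZ.integral_comp (f := fun x => x) (by fun_prop)

theorem integrable_pow_of_hasLaw_gauss {Ω : Type*} [MeasurableSpace Ω] {P : Measure Ω} {τ : ℝ≥0}
    {Z : Ω → ℝ} (hZ : HasLaw Z (gaussianReal 0 τ) P) {n : ℕ}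
    (hn : n ≠ 0) :
    Integrable (fun ω => Z ω ^ n) P := by
  have := (memLp_of_hasLaw_gauss hZ n).integrable_norm_pow (p := n) hn
  have hm := hZ.aemeasurable
  refine (integrable_norm_iff (hm.pow_const n).aestronglyMeasurable).1 ?_
  simpa using this

theorem variance_add_gauss {Ω : Type*} [MeasurableSpace Ω] {P : Measure Ω} {τ : ℝ≥0}
    {S Z : Ω → ℝ} (hS : MemLp S 2 P)
    (hZ : HasLaw Z (gaussianReal 0 τ) P)
    (hSZ : IndepFun S Z P) : variance (S + Z) P = variance S P + τ := by
  rw [hSZ.variance_add hS (memLp_of_hasLaw_gauss hZ 2), hZ.variance_eq, variance_id_gaussianReal]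

section noise

variable {Ω : Type*} [MeasurableSpace Ω] {P : Measure Ω} [IsProbabilityMeasure P]
  {τ : ℝ≥0} {S Z : Ω → ℝ}

theorem integral_sq_of_hasLaw_gauss (hZ : HasLaw Z (gaussianReal 0 τ) P) :
    ∫ ω, Z ω ^ 2 ∂P = τ := by
  have h := variance_eq_sub (memLp_of_hasLaw_gauss hZ 2)
  have h2 : variance Z P = τ := by
    rw [hZ.variance_eq, variance_id_gaussianReal]
  rw [h2, integral_of_hasLaw_gauss hZ] at h
  simpa using h.symm

theorem memLp_score_add_gauss (hτ : τ ≠ 0) (hS : AEMeasurable S P)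
    (hZ : HasLaw Z (gaussianReal 0 τ) P) (hSZ : IndepFun S Z P) :
    MemLp (fun ω => score P (S + Z) ((S + Z) ω)) 2 P := by
  have hZm := hZ.aemeasurable
  refine (memLp_two_iff_integrable_sq ((continuous_score_add_gauss hτ hS hZ
    hSZ).measurable.comp_aemeasurable (hS.add hZm)).aestronglyMeasurable).2 ?_
  have := (integral_indicator_score_sq_le hτ hS hZ hSZ (h := fun _ => 1) measurable_const
    (fun _ => zero_le_one) ?_).1
  · simpa using this
  · simp only [one_mul, div_pow]
    exact (integrable_pow_of_hasLaw_gauss hZ two_ne_zero).div_const _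

/-- Conditional expectation contracts the second moment, and `E(Z/τ)² = 1/τ`. -/
theorem fisherInfo_add_gauss_le (hτ : τ ≠ 0) (hS : AEMeasurable S P)
    (hZ : HasLaw Z (gaussianReal 0 τ) P) (hSZ : IndepFun S Z P) :
    fisherInfo P (S + Z) ≤ 1 / τ := by
  have h0 : (τ : ℝ) ≠ 0 := by exact_mod_cast hτ
  have := (integral_indicator_score_sq_le hτ hS hZ hSZ (h := fun _ => 1) measurable_const
    (fun _ => zero_le_one) ?_).2
  · simp only [one_mul, div_pow] at this
    rw [integral_div, integral_sq_of_hasLaw_gauss hZ] at this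
    refine this.trans (le_of_eq ?_)
    field_simp
  · simp only [one_mul, div_pow]
    exact (integrable_pow_of_hasLaw_gauss hZ two_ne_zero).div_const _

theorem integral_score_add_gauss (hτ : τ ≠ 0) (hS : AEMeasurable S P)
    (hZ : HasLaw Z (gaussianReal 0 τ) P) (hSZ : IndepFun S Z P) :
    ∫ ω, score P (S + Z) ((S + Z) ω) ∂P = 0 := by
  have h := integral_mul_score_add_gauss hτ hS hZ hSZ (h := fun _ => 1) measurable_const (by
    simpa using integrable_pow_of_hasLaw_gauss hZ one_ne_zero)
  simpa [integral_of_hasLaw_gauss hZ] using h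

/-- No integration by parts is needed: the left side is `-E[(S+Z)Z]/τ`, where `E[SZ] = 0` by
independence and `E Z² = τ`. -/
theorem integral_mul_score_self_add_gauss (hτ : τ ≠ 0) (hS : MemLp S 2 P)
    (hZ : HasLaw Z (gaussianReal 0 τ) P) (hSZ : IndepFun S Z P) :
    ∫ ω, (S + Z) ω * score P (S + Z) ((S + Z) ω) ∂P = -1 := by
  have h0 : (τ : ℝ) ≠ 0 := by exact_mod_cast hτ
  have hZ2 : MemLp Z 2 P := memLp_of_hasLaw_gauss hZ 2
  have i1 : Integrable (fun ω => S ω * Z ω) P := hS.integrable_mul hZ2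
  have i2 := integrable_pow_of_hasLaw_gauss hZ two_ne_zero
  have e : (fun ω => (S + Z) ω * Z ω) = fun ω => S ω * Z ω + Z ω ^ 2 := by
    ext ω; simp only [Pi.add_apply]; ring
  have h := integral_mul_score_add_gauss hτ hS.1.aemeasurable hZ hSZ (h := fun x => x)
    measurable_id (by rw [e]; exact i1.add i2)
  rw [h, e, integral_add i1 i2, hSZ.integral_fun_mul_eq_mul_integral hS.1 hZ2.1,
    integral_of_hasLaw_gauss hZ, integral_sq_of_hasLaw_gauss hZ]
  field_simp
  ring

/-- The standardised Fisher information is at most the scaled mean-square distance of the score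
to any affine function. -/
theorem fisherInfoSt_add_gauss_le (hτ : τ ≠ 0) (hS : MemLp S 2 P)
    (hZ : HasLaw Z (gaussianReal 0 τ) P) (hSZ : IndepFun S Z P) (A B : ℝ) :
    fisherInfoSt P (S + Z) ≤ variance (S + Z) P
      * ∫ ω, (score P (S + Z) ((S + Z) ω) - A - B * (S + Z) ω) ^ 2 ∂P := by
  have h0 : (0 : ℝ) < τ := by exact_mod_cast pos_iff_ne_zero.2 hτ
  have hX : MemLp (S + Z) 2 P := hS.add (memLp_of_hasLaw_gauss hZ 2)
  have hρ := memLp_score_add_gauss hτ hS.1.aemeasurable hZ hSZ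
  have e0 := integral_score_add_gauss hτ hS.1.aemeasurable hZ hSZ
  have e1 := integral_mul_score_self_add_gauss hτ hS hZ hSZ
  have ev := variance_eq_sub hX
  have hv : 0 < variance (S + Z) P := by
    rw [variance_add_gauss hS hZ hSZ]
    linarith [variance_nonneg S P]
  rw [fisherInfoSt, fisherInfo]
  set v := variance (S + Z) P
  set X := S + Z
  set ρ : Ω → ℝ := fun ω => score P X (X ω)
  have i1 : Integrable (fun ω => ρ ω ^ 2) P := hρ.integrable_sq
  have i2 : Integrable (fun ω => X ω ^ 2) P := hX.integrable_sq
  have i3 : Integrable (fun ω => X ω * ρ ω) P := hX.integrable_mul hρ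
  have i4 : Integrable ρ P := hρ.integrable (by norm_num)
  have i5 : Integrable X P := hX.integrable (by norm_num)
  have e : ∀ ω, (ρ ω - A - B * X ω) ^ 2 = ρ ω ^ 2 + B ^ 2 * X ω ^ 2 + (-2 * B) * (X ω * ρ ω)
      + (-2 * A) * ρ ω + (2 * A * B) * X ω + A ^ 2 := fun ω => by ring
  change v * ∫ ω, ρ ω ^ 2 ∂P - 1 ≤ v * ∫ ω, (ρ ω - A - B * X ω) ^ 2 ∂P
  simp_rw [e]
  rw [integral_add (by fun_prop) (by fun_prop), integral_add (by fun_prop) (by fun_prop),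
    integral_add (by fun_prop) (by fun_prop), integral_add (by fun_prop) (by fun_prop),
    integral_add (by fun_prop) (by fun_prop)]
  simp only [integral_const_mul, integral_const, probReal_univ, smul_eq_mul, one_mul]
  rw [show ∫ ω, X ω * ρ ω ∂P = -1 from e1, show ∫ ω, ρ ω ∂P = 0 from e0]
  have e2 : ∫ ω, X ω ^ 2 ∂P = v + (∫ ω, X ω ∂P) ^ 2 := by
    have : v = ∫ ω, X ω ^ 2 ∂P - (∫ ω, X ω ∂P) ^ 2 := ev
    linarith
  rw [e2]
  generalize ∫ ω, X ω ∂P = m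
  generalize ∫ ω, ρ ω ^ 2 ∂P = J
  -- With `m` the mean, the right side minus the left is `(B v + 1)² + v (A + B m)²`.
  nlinarith [sq_nonneg (B * v + 1), mul_nonneg hv.le (sq_nonneg (A + B * m))]

/-- Mean-square distance of the score to an affine function that is uniformly close to it on
`[-R, R]`. -/
theorem integral_sq_score_sub_affine_le (hτ : τ ≠ 0) (hS : MemLp S 2 P)
    (hZ : HasLaw Z (gaussianReal 0 τ) P) (hSZ : IndepFun S Z P) {A B G R η t : ℝ} (hR : 1 ≤ R)
    (ht : 0 < t) (hA : |A| ≤ G) (hB : |B| ≤ G)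
    (hη : ∀ x, |x| ≤ R → |score P (S + Z) x - A - B * x| ≤ η) :
    ∫ ω, (score P (S + Z) ((S + Z) ω) - A - B * (S + Z) ω) ^ 2 ∂P
      ≤ η ^ 2 + 2 * ((t * ∫ z, z ^ 4 ∂(gaussianReal 0 τ)) / τ ^ 2)
        + (2 / (4 * t * τ ^ 2) + 8 * G ^ 2)
          * ∫ ω, {x : ℝ | R < |x|}.indicator (fun x => x ^ 2) ((S + Z) ω) ∂P := by
  have h0 : (0 : ℝ) < τ := by exact_mod_cast pos_iff_ne_zero.2 hτ
  have hZm := hZ.aemeasurable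
  have hX : MemLp (S + Z) 2 P := hS.add (memLp_of_hasLaw_gauss hZ 2)
  have hρ := memLp_score_add_gauss hτ hS.1.aemeasurable hZ hSZ
  have hs : MeasurableSet {x : ℝ | R < |x|} := measurableSet_lt (by fun_prop) (by fun_prop)
  let h : ℝ → ℝ := {x : ℝ | R < |x|}.indicator fun _ => 1
  have hh : Measurable h := measurable_const.indicator hs
  have h01 : ∀ x, 0 ≤ h x := fun x => Set.indicator_nonneg (fun _ _ => zero_le_one) x
  have hq : ∀ x, {x : ℝ | R < |x|}.indicator (fun x => x ^ 2) x = h x * x ^ 2 := by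
    intro x
    by_cases hx : x ∈ {x : ℝ | R < |x|} <;> simp [h, hx]
  have hle1 : ∀ x, h x ≤ 1 := fun x => Set.indicator_le_self' (fun _ _ => zero_le_one) x
  -- Since `R ≥ 1`, the tail probability is absorbed into the tail second moment.
  have hle : ∀ x, h x ≤ h x * x ^ 2 := by
    intro x
    by_cases hx : x ∈ {x : ℝ | R < |x|}
    · have : R < |x| := hx
      have h2 : 1 ≤ x ^ 2 := by rw [← sq_abs]; nlinarith
      simpa [h, hx] using h2
    · simp [h, hx]
  simp_rw [hq]
  set X := S + Z
  have hXm : AEMeasurable X P := hX.1.aemeasurable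
  have iX2 : Integrable (fun ω => X ω ^ 2) P := hX.integrable_sq
  have iZ4 := integrable_pow_of_hasLaw_gauss hZ (n := 4) (by norm_num)
  have iZ2 := integrable_pow_of_hasLaw_gauss hZ two_ne_zero
  have ihX : Integrable (fun ω => h (X ω) * X ω ^ 2) P := by
    refine iX2.mono' (by fun_prop) (ae_of_all _ fun ω => ?_)
    rw [Real.norm_eq_abs, abs_of_nonneg (mul_nonneg (h01 _) (sq_nonneg _))]
    nlinarith [hle1 (X ω), sq_nonneg (X ω)]
  have ihZ : Integrable (fun ω => h (X ω) * (Z ω / τ) ^ 2) P := by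
    refine (iZ2.div_const ((τ : ℝ) ^ 2)).mono' (by fun_prop) (ae_of_all _ fun ω => ?_)
    rw [Real.norm_eq_abs, abs_of_nonneg (mul_nonneg (h01 _) (sq_nonneg _)), div_pow]
    have : 0 ≤ Z ω ^ 2 / (τ : ℝ) ^ 2 := by positivity
    nlinarith [hle1 (X ω)]
  obtain ⟨j1, j2⟩ := integral_indicator_score_sq_le hτ hS.1.aemeasurable hZ hSZ hh h01 ihZ
  have eZ4 : ∫ z, z ^ 4 ∂(gaussianReal 0 τ) = ∫ ω, Z ω ^ 4 ∂P :=
    (hZ.integral_comp (f := fun x => x ^ 4) (by fun_prop)).symm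
  have hZbd : ∫ ω, h (X ω) * (Z ω / τ) ^ 2 ∂P
      ≤ (t / τ ^ 2) * ∫ ω, Z ω ^ 4 ∂P
        + (1 / (4 * t * τ ^ 2)) * ∫ ω, h (X ω) * X ω ^ 2 ∂P := by
    rw [← integral_const_mul, ← integral_const_mul, ← integral_add (by fun_prop) (by fun_prop)]
    refine integral_mono ihZ (by fun_prop) fun ω => ?_
    -- Young's inequality with a free `t`: the fourth moment gets a small factor, while the large
    -- factor `1/(4t)` falls on the tail of `X`.
    have a1 : Z ω ^ 2 ≤ t * Z ω ^ 4 + 1 / (4 * t) := by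
      have : t * Z ω ^ 4 + 1 / (4 * t) - Z ω ^ 2 = t * (Z ω ^ 2 - 1 / (2 * t)) ^ 2 := by
        field_simp; ring
      have : 0 ≤ t * (Z ω ^ 2 - 1 / (2 * t)) ^ 2 := by positivity
      linarith
    have a2 : h (X ω) * Z ω ^ 2 ≤ t * Z ω ^ 4 + 1 / (4 * t) * (h (X ω) * X ω ^ 2) := by
      calc h (X ω) * Z ω ^ 2 ≤ h (X ω) * (t * Z ω ^ 4 + 1 / (4 * t)) :=
            mul_le_mul_of_nonneg_left a1 (h01 _)
        _ = h (X ω) * (t * Z ω ^ 4) + 1 / (4 * t) * h (X ω) := by ring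
        _ ≤ 1 * (t * Z ω ^ 4) + 1 / (4 * t) * (h (X ω) * X ω ^ 2) := by
            gcongr
            · exact hle1 _
            · exact hle _
        _ = _ := by ring
    calc h (X ω) * (Z ω / τ) ^ 2 = (h (X ω) * Z ω ^ 2) / τ ^ 2 := by ring
      _ ≤ (t * Z ω ^ 4 + 1 / (4 * t) * (h (X ω) * X ω ^ 2)) / τ ^ 2 := by gcongr
      _ = _ := by field_simp
  have hG : 0 ≤ G := (abs_nonneg A).trans hA
  have hpt : ∀ ω, (score P X (X ω) - A - B * X ω) ^ 2
      ≤ η ^ 2 + 2 * (h (X ω) * score P X (X ω) ^ 2) + 8 * G ^ 2 * (h (X ω) * X ω ^ 2) := by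
    intro ω
    by_cases hx : |X ω| ≤ R
    · have := hη _ hx
      have h1 : (score P X (X ω) - A - B * X ω) ^ 2 ≤ η ^ 2 := by
        rw [← sq_abs]; exact pow_le_pow_left₀ (abs_nonneg _) this 2
      have h2 := mul_nonneg (h01 (X ω)) (sq_nonneg (score P X (X ω)))
      have h3 := mul_nonneg (sq_nonneg G) (mul_nonneg (h01 (X ω)) (sq_nonneg (X ω)))
      linarith
    · have hmem : X ω ∈ {x : ℝ | R < |x|} := not_le.1 hx
      have e : h (X ω) = 1 := by simp [h, hmem]
      have h2 := hle (X ω)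
      rw [e, one_mul] at h2 ⊢
      rw [one_mul]
      have hA2 : A ^ 2 ≤ G ^ 2 := by rw [← sq_abs]; exact pow_le_pow_left₀ (abs_nonneg _) hA 2
      have hB2 : B ^ 2 ≤ G ^ 2 := by rw [← sq_abs]; exact pow_le_pow_left₀ (abs_nonneg _) hB 2
      have h4 : B ^ 2 * X ω ^ 2 ≤ G ^ 2 * X ω ^ 2 := by gcongr
      have h5 : A ^ 2 ≤ G ^ 2 * X ω ^ 2 := by nlinarith [sq_nonneg G]
      nlinarith [sq_nonneg (score P X (X ω) + A + B * X ω), sq_nonneg (A - B * X ω), sq_nonneg η]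
  have j1' : Integrable (fun ω => h (X ω) * score P X (X ω) ^ 2) P := j1
  have j2' : ∫ ω, h (X ω) * score P X (X ω) ^ 2 ∂P ≤ ∫ ω, h (X ω) * (Z ω / τ) ^ 2 ∂P := j2
  have hmono : ∫ ω, (score P X (X ω) - A - B * X ω) ^ 2 ∂P
      ≤ ∫ ω, (η ^ 2 + 2 * (h (X ω) * score P X (X ω) ^ 2)
        + 8 * G ^ 2 * (h (X ω) * X ω ^ 2)) ∂P := by
    refine integral_mono_of_nonneg (ae_of_all _ fun ω => sq_nonneg _) ?_ (ae_of_all _ hpt)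
    fun_prop
  rw [integral_add (by fun_prop) (by fun_prop), integral_add (by fun_prop) (by fun_prop)] at hmono
  simp only [integral_const_mul, integral_const, probReal_univ, smul_eq_mul, one_mul] at hmono
  rw [eZ4]
  have e5 : (2 / (4 * t * (τ : ℝ) ^ 2)) = 2 * (1 / (4 * t * τ ^ 2)) := by ring
  have e6 : (t * ∫ ω, Z ω ^ 4 ∂P) / (τ : ℝ) ^ 2 = (t / τ ^ 2) * ∫ ω, Z ω ^ 4 ∂P := by ring
  rw [e5, e6]
  nlinarith [j2', hZbd, hmono]

end noise

/-! ### Consequences of the tail condition -/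

section tails

variable {Ω : Type*} [MeasurableSpace Ω] {P : Measure Ω} [IsProbabilityMeasure P] {X : Ω → ℝ}

/-- The tail condition is not centred, so it controls the mean as well as the spread: below the
threshold `X² ≤ R² Var(X)`, and the rest contributes at most `Var(X)`. -/
theorem TailClass.integral_sq_le {ψ : ℝ → ℝ} (hX : TailClass ψ P X) {R V : ℝ} (hR : 0 < R)
    (hψ : |ψ R| ≤ 1) (hV : variance X P ≤ V) : ∫ ω, X ω ^ 2 ∂P ≤ V * (R ^ 2 + 1) := by
  have hv := variance_nonneg X P
  have hXm := hX.1.1.aemeasurable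
  have iX : Integrable (fun ω => X ω ^ 2) P := hX.1.integrable_sq
  have hs : NullMeasurableSet {ω | R * √(variance X P) ≤ |X ω|} P :=
    nullMeasurableSet_le (by fun_prop) (by fun_prop)
  have i2 : Integrable ({ω | R * √(variance X P) ≤ |X ω|}.indicator (fun ω => X ω ^ 2)) P :=
    iX.indicator₀ hs
  have h1 : ∫ ω, X ω ^ 2 ∂P ≤ ∫ ω, ({ω | R * √(variance X P) ≤ |X ω|}.indicator
      (fun ω => X ω ^ 2) ω + R ^ 2 * variance X P) ∂P := by
    refine integral_mono iX (i2.add (integrable_const _)) fun ω => ?_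
    by_cases hω : ω ∈ {ω | R * √(variance X P) ≤ |X ω|}
    · simp only [Set.indicator_of_mem hω]
      have : 0 ≤ R ^ 2 * variance X P := by positivity
      linarith
    · simp only [Set.indicator_of_notMem hω, zero_add]
      have h2 : |X ω| ≤ R * √(variance X P) := (not_le.1 hω).le
      have h3 := pow_le_pow_left₀ (abs_nonneg _) h2 2
      rwa [sq_abs, mul_pow, Real.sq_sqrt hv] at h3
  rw [integral_add i2 (integrable_const _)] at h1
  simp only [integral_const, probReal_univ, smul_eq_mul, one_mul] at h1
  have h2 := hX.2 R hR
  have h3 : variance X P * ψ R ≤ variance X P * 1 :=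
    mul_le_mul_of_nonneg_left ((le_abs_self _).trans hψ) hv
  nlinarith [sq_nonneg R]

/-- By Markov's inequality each of `S² ≥ 4C` and `T² ≥ 4C` has probability at most `1/4`. -/
theorem half_le_measureReal_abs_le {S T : Ω → ℝ} (hS : MemLp S 2 P) (hT : MemLp T 2 P) {C : ℝ}
    (hC : 0 < C) (hS2 : ∫ ω, S ω ^ 2 ∂P ≤ C) (hT2 : ∫ ω, T ω ^ 2 ∂P ≤ C) :
    1 / 2 ≤ P.real {ω | |S ω| ≤ 2 * √C ∧ |T ω| ≤ 2 * √C} := by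
  have key : ∀ U : Ω → ℝ, MemLp U 2 P → ∫ ω, U ω ^ 2 ∂P ≤ C →
      P.real {ω | 4 * C ≤ U ω ^ 2} ≤ 1 / 4 := by
    intro U hU hU2
    have := mul_meas_ge_le_integral_of_nonneg (ae_of_all P fun ω => sq_nonneg (U ω))
      hU.integrable_sq (4 * C)
    nlinarith
  have hcov : (Set.univ : Set Ω) ⊆ {ω | |S ω| ≤ 2 * √C ∧ |T ω| ≤ 2 * √C}
      ∪ ({ω | 4 * C ≤ S ω ^ 2} ∪ {ω | 4 * C ≤ T ω ^ 2}) := by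
    intro ω _
    have h : ∀ u : ℝ, ¬ 4 * C ≤ u ^ 2 → |u| ≤ 2 * √C := by
      intro u hu
      refine abs_le_of_sq_le_sq ?_ (by positivity)
      rw [mul_pow, Real.sq_sqrt hC.le]
      linarith
    by_cases h1 : 4 * C ≤ S ω ^ 2
    · exact Or.inr (Or.inl h1)
    · by_cases h2 : 4 * C ≤ T ω ^ 2
      · exact Or.inr (Or.inr h2)
      · exact Or.inl ⟨h _ h1, h _ h2⟩
  have h1 := measureReal_mono (μ := P) hcov
  rw [probReal_univ] at h1
  have h2 := h1.trans (measureReal_union_le _ _)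
  have h3 := measureReal_union_le (μ := P) {ω | 4 * C ≤ S ω ^ 2} {ω | 4 * C ≤ T ω ^ 2}
  linarith [key S hS hS2, key T hT hT2]

end tails

/-- Replacing the variance by its upper bound `V` raises the threshold, giving one cut-off for the
whole class. -/
theorem TailClass.integral_indicator_le {Ω : Type*} [MeasurableSpace Ω] {P : Measure Ω}
    {X : Ω → ℝ} {ψ : ℝ → ℝ} (hX : TailClass ψ P X) {R V θ : ℝ} (hR : 0 < R) (hψ : |ψ R| ≤ θ)
    (hV : variance X P ≤ V) :
    ∫ ω, {x : ℝ | R * √V < |x|}.indicator (fun x => x ^ 2) (X ω) ∂P ≤ V * θ := by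
  have hv := variance_nonneg X P
  have hXm := hX.1.1.aemeasurable
  have iX : Integrable (fun ω => X ω ^ 2) P := hX.1.integrable_sq
  have hs : NullMeasurableSet {ω | R * √(variance X P) ≤ |X ω|} P :=
    nullMeasurableSet_le (by fun_prop) (by fun_prop)
  have h1 : ∫ ω, {x : ℝ | R * √V < |x|}.indicator (fun x => x ^ 2) (X ω) ∂P
      ≤ ∫ ω, {ω | R * √(variance X P) ≤ |X ω|}.indicator (fun ω => X ω ^ 2) ω ∂P := by
    refine integral_mono_of_nonneg (ae_of_all _ fun ω => Set.indicator_nonneg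
      (fun x _ => sq_nonneg x) _) (iX.indicator₀ hs) (ae_of_all _ fun ω => ?_)
    by_cases hω : X ω ∈ {x : ℝ | R * √V < |x|}
    · have h2 : R * √V < |X ω| := hω
      have h3 : R * √(variance X P) ≤ R * √V := by gcongr
      have hω' : ω ∈ {ω | R * √(variance X P) ≤ |X ω|} := h3.trans h2.le
      simp only [Set.indicator_of_mem hω, Set.indicator_of_mem hω', le_refl]
    · simp only [Set.indicator_of_notMem hω]
      exact Set.indicator_nonneg (fun _ _ => sq_nonneg _) _
  have hθ : 0 ≤ θ := (abs_nonneg _).trans hψ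
  calc _ ≤ _ := h1
    _ ≤ variance X P * ψ R := hX.2 R hR
    _ ≤ variance X P * θ := mul_le_mul_of_nonneg_left ((le_abs_self _).trans hψ) hv
    _ ≤ V * θ := by gcongr

/-! ### Construction of the modulus -/

/-- A modulus dominating a family of pairs that is bounded above and tends to zero with the
first coordinate. -/
theorem exists_modulus {A : Set (ℝ × ℝ)} {C : ℝ} (hC : ∀ q ∈ A, q.2 ≤ C)
    (hA : ∀ κ, 0 < κ → ∃ ε, 0 < ε ∧ ∀ q ∈ A, q.1 < ε → q.2 ≤ κ) :
    ∃ ν : ℝ → ℝ, Tendsto ν (𝓝 0) (𝓝 0) ∧ ∀ q ∈ A, q.2 ≤ ν q.1 := by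
  -- Inserting `0` makes the supremum nonnegative, also where no pair is attained; the upper
  -- estimate near zero then covers the point `0` itself and gives `ν 0 = 0`.
  let s : ℝ → Set ℝ := fun d => insert 0 {r | (d, r) ∈ A}
  have hb : ∀ d, BddAbove (s d) := by
    refine fun d => ⟨max 0 C, ?_⟩
    rintro r (rfl | hr)
    · exact le_max_left _ _
    · exact (hC _ hr).trans (le_max_right _ _)
  refine ⟨fun d => sSup (s d), ?_, fun q hq => le_csSup (hb q.1) (Set.mem_insert_of_mem _ hq)⟩
  refine Metric.tendsto_nhds.2 fun κ hκ => ?_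
  obtain ⟨ε, hε, h⟩ := hA (κ / 2) (by positivity)
  filter_upwards [gt_mem_nhds hε] with d hd
  have h0 : 0 ≤ sSup (s d) := le_csSup (hb d) (Set.mem_insert _ _)
  have h1 : sSup (s d) ≤ κ / 2 := by
    refine csSup_le (Set.insert_nonempty _ _) ?_
    rintro r (rfl | hr)
    · positivity
    · exact h _ hr hd
  rw [Real.dist_eq, sub_zero, abs_of_nonneg h0]
  linarith

/-! ### The class of noisy pairs and its uniform bounds -/

/-- The family of pairs `(X, Y) = (S + ZS, T + ZT)` and weights `β` over which the bound is
uniform. -/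
structure NoisyPair (ψ : ℝ → ℝ) (δ K : ℝ) (τ : ℝ≥0) {Ω : Type*} [MeasurableSpace Ω]
    (P : Measure Ω) (S T ZS ZT : Ω → ℝ) (β : ℝ) : Prop where
  isProb : IsProbabilityMeasure P
  memLp_left : MemLp S 2 P
  memLp_right : MemLp T 2 P
  variance_le : max (variance S P) (variance T P) ≤ K * τ
  law_left : HasLaw ZS (gaussianReal 0 τ) P
  law_right : HasLaw ZT (gaussianReal 0 τ) P
  indep : IndepFun (fun ω => (S ω, T ω)) (fun ω => (ZS ω, ZT ω)) P
  indep_noise : IndepFun ZS ZT P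
  tail_left : TailClass ψ P (S + ZS)
  tail_right : TailClass ψ P (T + ZT)
  lt_weight : δ < β
  weight_lt : β < 1 - δ

namespace NoisyPair

variable {ψ : ℝ → ℝ} {δ K : ℝ} {τ : ℝ≥0} {Ω : Type*} [MeasurableSpace Ω] {P : Measure Ω}
  {S T ZS ZT : Ω → ℝ} {β : ℝ}

theorem indep_left (h : NoisyPair ψ δ K τ P S T ZS ZT β) : IndepFun S ZS P :=
  h.indep.comp measurable_fst measurable_fst

theorem indep_right (h : NoisyPair ψ δ K τ P S T ZS ZT β) : IndepFun T ZT P :=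
  h.indep.comp measurable_snd measurable_snd

theorem indep_mix (h : NoisyPair ψ δ K τ P S T ZS ZT β) : IndepFun (mix β S T) (mix β ZS ZT) P :=
  indepFun_mix h.indep β

theorem memLp_mix (h : NoisyPair ψ δ K τ P S T ZS ZT β) : MemLp (mix β S T) 2 P :=
  (h.memLp_left.const_mul _).add (h.memLp_right.const_mul _)

theorem law_mix (hδ : 0 < δ) (h : NoisyPair ψ δ K τ P S T ZS ZT β) :
    HasLaw (mix β ZS ZT) (gaussianReal 0 τ) P := by
  have := h.isProb
  exact hasLaw_mix h.law_left h.law_right h.indep_noise (by linarith [h.lt_weight])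
    (by linarith [h.weight_lt])

theorem exists_isC1Density (hδ : 0 < δ) (hτ : τ ≠ 0) (h : NoisyPair ψ δ K τ P S T ZS ZT β) :
    (∃ p, IsC1Density P (S + ZS) p) ∧ (∃ p, IsC1Density P (T + ZT) p) ∧
      ∃ p, IsC1Density P (mix β (S + ZS) (T + ZT)) p := by
  have := h.isProb
  rw [mix_add]
  exact ⟨⟨_, isC1Density_add_gauss hτ h.memLp_left.1.aemeasurable h.law_left h.indep_left⟩,
    ⟨_, isC1Density_add_gauss hτ h.memLp_right.1.aemeasurable h.law_right h.indep_right⟩,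
    ⟨_, isC1Density_add_gauss hτ h.memLp_mix.1.aemeasurable (h.law_mix hδ) h.indep_mix⟩⟩

theorem integrable_score_sq (hτ : τ ≠ 0) (h : NoisyPair ψ δ K τ P S T ZS ZT β) :
    Integrable (fun ω => score P (S + ZS) ((S + ZS) ω) ^ 2) P := by
  have := h.isProb
  exact (memLp_score_add_gauss hτ h.memLp_left.1.aemeasurable h.law_left
    h.indep_left).integrable_sq

theorem integrable_scoreDefect_sq (hδ : 0 < δ) (hτ : τ ≠ 0)
    (h : NoisyPair ψ δ K τ P S T ZS ZT β) :
    Integrable (fun ω => scoreDefect P (S + ZS) (T + ZT) β ω ^ 2) P := by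
  have := h.isProb
  have h1 := memLp_score_add_gauss hτ h.memLp_left.1.aemeasurable h.law_left h.indep_left
  have h2 := memLp_score_add_gauss hτ h.memLp_right.1.aemeasurable h.law_right h.indep_right
  have h3 := memLp_score_add_gauss hτ h.memLp_mix.1.aemeasurable (h.law_mix hδ) h.indep_mix
  rw [← mix_add] at h3
  exact (((h1.const_mul √β).add (h2.const_mul √(1 - β))).sub h3).integrable_sq

theorem variance_left_le (h : NoisyPair ψ δ K τ P S T ZS ZT β) :
    variance (S + ZS) P ≤ (|K| + 1) * τ := by
  have := h.isProb
  rw [variance_add_gauss h.memLp_left h.law_left h.indep_left]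
  have h1 := (le_max_left _ _).trans h.variance_le
  nlinarith [le_abs_self K, τ.coe_nonneg]

theorem variance_right_le (h : NoisyPair ψ δ K τ P S T ZS ZT β) :
    variance (T + ZT) P ≤ (|K| + 1) * τ := by
  have := h.isProb
  rw [variance_add_gauss h.memLp_right h.law_right h.indep_right]
  have h1 := (le_max_right _ _).trans h.variance_le
  nlinarith [le_abs_self K, τ.coe_nonneg]

/-- The variance is at most `(|K|+1)τ` and the Fisher information at most `1/τ`. This keeps the
supremum defining the modulus finite. -/
theorem fisherInfoSt_le (hτ : τ ≠ 0) (h : NoisyPair ψ δ K τ P S T ZS ZT β) :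
    fisherInfoSt P (S + ZS) ≤ |K| + 1 := by
  have := h.isProb
  have h0 : (0 : ℝ) < τ := by exact_mod_cast pos_iff_ne_zero.2 hτ
  have h1 := fisherInfo_add_gauss_le hτ h.memLp_left.1.aemeasurable h.law_left h.indep_left
  have h2 : variance (S + ZS) P * fisherInfo P (S + ZS) ≤ ((|K| + 1) * τ) * (1 / τ) :=
    mul_le_mul h.variance_left_le h1 (integral_nonneg fun ω => sq_nonneg _) (by positivity)
  have e : ((|K| + 1) * (τ : ℝ)) * (1 / τ) = |K| + 1 := by field_simp
  rw [fisherInfoSt]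
  linarith

end NoisyPair

theorem integral_sq_le_of_add_gauss {Ω : Type*} [MeasurableSpace Ω] {P : Measure Ω} {τ : ℝ≥0}
    {S Z : Ω → ℝ} (hS : MemLp S 2 P) [IsProbabilityMeasure P]
    (hZ : HasLaw Z (gaussianReal 0 τ) P) {C : ℝ}
    (hC : ∫ ω, (S + Z) ω ^ 2 ∂P ≤ C) : ∫ ω, S ω ^ 2 ∂P ≤ 2 * C + 2 * τ := by
  have hZ2 : MemLp Z 2 P := memLp_of_hasLaw_gauss hZ 2
  have i1 : Integrable (fun ω => (S + Z) ω ^ 2) P := (hS.add hZ2).integrable_sq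
  have i2 : Integrable (fun ω => Z ω ^ 2) P := hZ2.integrable_sq
  have h : ∫ ω, S ω ^ 2 ∂P ≤ ∫ ω, (2 * (S + Z) ω ^ 2 + 2 * Z ω ^ 2) ∂P := by
    refine integral_mono hS.integrable_sq ((i1.const_mul 2).add (i2.const_mul 2)) fun ω => ?_
    simp only [Pi.add_apply]
    nlinarith [sq_nonneg (S ω + 2 * Z ω)]
  rw [integral_add (i1.const_mul 2) (i2.const_mul 2), integral_const_mul, integral_const_mul,
    integral_sq_of_hasLaw_gauss hZ] at h
  linarith

/-- The components of the pair are uniformly tight. -/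
theorem NoisyPair.exists_tight {ψ : ℝ → ℝ} (hψ : Tendsto ψ atTop (𝓝 0)) (δ K : ℝ) {τ : ℝ≥0}
    (hτ : τ ≠ 0) :
    ∃ M, 0 < M ∧ ∀ {Ω : Type*} [MeasurableSpace Ω] {P : Measure Ω} {S T ZS ZT : Ω → ℝ} {β : ℝ},
      NoisyPair ψ δ K τ P S T ZS ZT β → 1 / 2 ≤ P.real {ω | |S ω| ≤ M ∧ |T ω| ≤ M} := by
  have h0 : (0 : ℝ) < τ := by exact_mod_cast pos_iff_ne_zero.2 hτ
  obtain ⟨R, hR1, hR0⟩ := ((hψ.abs.eventually (ge_mem_nhds (by simp : |(0 : ℝ)| < 1))).and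
    (eventually_gt_atTop 0)).exists
  set V := (|K| + 1) * (τ : ℝ)
  have hC : 0 < 2 * (V * (R ^ 2 + 1)) + 2 * (τ : ℝ) := by positivity
  refine ⟨2 * √(2 * (V * (R ^ 2 + 1)) + 2 * τ), by positivity, ?_⟩
  intro Ω _ P S T ZS ZT β h
  have := h.isProb
  exact half_le_measureReal_abs_le h.memLp_left h.memLp_right hC
    (integral_sq_le_of_add_gauss h.memLp_left h.law_left
      (h.tail_left.integral_sq_le hR0 hR1 h.variance_left_le))
    (integral_sq_le_of_add_gauss h.memLp_right h.law_right
      (h.tail_right.integral_sq_le hR0 hR1 h.variance_right_le))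

theorem half_le_map_real {Ω : Type*} [MeasurableSpace Ω] {P : Measure Ω} [IsProbabilityMeasure P]
    {S T U : Ω → ℝ} {M : ℝ} (hU : AEMeasurable U P)
    (hM : 1 / 2 ≤ P.real {ω | |S ω| ≤ M ∧ |T ω| ≤ M}) (hle : ∀ ω, |U ω| ≤ |S ω| + |T ω|) :
    1 / 2 ≤ (P.map U).real {s | |s| ≤ 2 * M} := by
  rw [map_measureReal_apply_of_aemeasurable hU (measurableSet_le (by fun_prop) (by fun_prop))]
  refine hM.trans (measureReal_mono ?_)
  rintro ω ⟨h1, h2⟩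
  change |U ω| ≤ 2 * M
  linarith [hle ω]

theorem abs_mix_le {β x y : ℝ} (h0 : 0 ≤ β) (h1 : β ≤ 1) :
    |√β * x + √(1 - β) * y| ≤ |x| + |y| := by
  have a1 : √β ≤ 1 := Real.sqrt_le_one.2 h1
  have a2 : √(1 - β) ≤ 1 := Real.sqrt_le_one.2 (by linarith)
  refine (abs_add_le _ _).trans ?_
  rw [abs_mul, abs_mul, abs_of_nonneg (Real.sqrt_nonneg _), abs_of_nonneg (Real.sqrt_nonneg _)]
  nlinarith [abs_nonneg x, abs_nonneg y]

/-! ### From the score defect to the Fisher information -/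

/-- A small score defect forces the score to be nearly affine on bounded intervals. -/
theorem NoisyPair.exists_affine_approx {ψ : ℝ → ℝ} (hψ : Tendsto ψ atTop (𝓝 0)) {δ : ℝ}
    (hδ : 0 < δ) (K : ℝ) {τ : ℝ≥0} (hτ : τ ≠ 0) :
    ∃ G, 0 < G ∧ ∀ R η, 1 ≤ R → 0 < η → η ≤ 1 → ∃ ε, 0 < ε ∧
      ∀ {Ω : Type*} [MeasurableSpace Ω] {P : Measure Ω} {S T ZS ZT : Ω → ℝ} {β : ℝ},
      NoisyPair ψ δ K τ P S T ZS ZT β → scoreDelta P (S + ZS) (T + ZT) β < ε →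
      ∃ A B, |A| ≤ G ∧ |B| ≤ G ∧ ∀ x, |x| ≤ R → |score P (S + ZS) x - A - B * x| ≤ η := by
  obtain ⟨M, hM0, hM⟩ := NoisyPair.exists_tight hψ δ K hτ
  -- The affine coefficients are read off from the score at `0` and `1`, so their bound depends on
  -- neither `R` nor `η`; the cut-off `R` can later be chosen after `G`.
  obtain ⟨G, hG0, hG⟩ := exists_score_bound hτ (2 * M) 1
  refine ⟨2 * G + 1, by linarith, fun R η hR hη hη1 => ?_⟩
  have hd : 0 < √δ := Real.sqrt_pos.2 hδ
  set R' := R / √δ with hR'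
  -- The radius covers the mixed argument when both coordinates are at most `R' + 1`; the tightness
  -- level `2M` covers `|S| + |T|`, hence the mixed signal.
  obtain ⟨L, hL0, hL⟩ := exists_score_bound hτ (2 * M) (2 * (R' + 1))
  have hg := gaussianPDFReal_pos 0 τ (R' + 1 + M) hτ
  obtain ⟨ε, hε, hmain⟩ := exists_forall_abs_le_of_integral_sq_lt (L := 2 * L)
    (c := 2 * gaussianPDFReal 0 τ (R' + 1 + M) ^ 2) (R := R') (η := η * √δ / 12)
    (by positivity) (by positivity) (by positivity)
  refine ⟨ε, hε, ?_⟩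
  intro Ω _ P S T ZS ZT β h hlt
  have := h.isProb
  have hβ0 : 0 ≤ β := by linarith [h.lt_weight]
  have hβ1 : β ≤ 1 := by linarith [h.weight_lt]
  have hSm := h.memLp_left.1.aemeasurable
  have hTm := h.memLp_right.1.aemeasurable
  have hUm := h.memLp_mix.1.aemeasurable
  have pS : IsProbabilityMeasure (P.map S) := Measure.isProbabilityMeasure_map hSm
  have pT : IsProbabilityMeasure (P.map T) := Measure.isProbabilityMeasure_map hTm
  have pU : IsProbabilityMeasure (P.map (mix β S T)) := Measure.isProbabilityMeasure_map hUm
  have tS := half_le_map_real hSm (hM h) fun ω => by linarith [abs_nonneg (T ω)]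
  have tT := half_le_map_real hTm (hM h) fun ω => by linarith [abs_nonneg (S ω)]
  have tU := half_le_map_real hUm (hM h) fun ω => abs_mix_le hβ0 hβ1
  have bS := hG (P.map S) tS
  have lS := (hL (P.map S) tS).2
  have lT := (hL (P.map T) tT).2
  have lU := (hL (P.map (mix β S T)) tU).2
  have sS := score_add_gauss hτ hSm h.law_left h.indep_left
  have sT := score_add_gauss hτ hTm h.law_right h.indep_right
  have sU := score_add_gauss hτ hUm (h.law_mix hδ) h.indep_mix
  have a0 : 0 ≤ √β := Real.sqrt_nonneg _
  have b0 : 0 ≤ √(1 - β) := Real.sqrt_nonneg _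
  have a1 : √β ≤ 1 := Real.sqrt_le_one.2 hβ1
  have b1 : √(1 - β) ≤ 1 := Real.sqrt_le_one.2 (by linarith)
  have hdef := hmain P (S + ZS) (T + ZT)
    (fun x y => √β * score P (S + ZS) x + √(1 - β) * score P (T + ZT) y
      - score P (mix β (S + ZS) (T + ZT)) (√β * x + √(1 - β) * y))
    (by
      intro x y x' y' hx hy hx' hy'
      have k1 : |x'| ≤ R' + 1 := by
        have := abs_sub_abs_le_abs_sub x' x; linarith
      have k2 : |y'| ≤ R' + 1 := by
        have := abs_sub_abs_le_abs_sub y' y; linarith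
      have hR0 : 0 ≤ R' := (abs_nonneg x).trans hx
      have m1 : |√β * x + √(1 - β) * y| ≤ 2 * (R' + 1) := (abs_mix_le hβ0 hβ1).trans (by linarith)
      have m2 : |√β * x' + √(1 - β) * y'| ≤ 2 * (R' + 1) :=
        (abs_mix_le hβ0 hβ1).trans (by linarith)
      have q1 := lS x' x (by linarith) (by linarith)
      have q2 := lT y' y (by linarith) (by linarith)
      have q3 := lU _ _ m2 m1
      have e3 : √β * x' + √(1 - β) * y' - (√β * x + √(1 - β) * y)
          = √β * (x' - x) + √(1 - β) * (y' - y) := by ring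
      have m3 : |√β * x' + √(1 - β) * y' - (√β * x + √(1 - β) * y)| ≤ |x' - x| + |y' - y| := by
        rw [e3]; exact abs_mix_le hβ0 hβ1
      have q3' := q3.trans (mul_le_mul_of_nonneg_left m3 hL0.le)
      rw [mix_add, sS, sT, sU]
      beta_reduce
      set u1 := convAvg (gaussDeriv τ) (P.map S) x / convAvg (gaussianPDFReal 0 τ) (P.map S) x
      set u2 := convAvg (gaussDeriv τ) (P.map S) x' / convAvg (gaussianPDFReal 0 τ) (P.map S) x'
      set u3 := convAvg (gaussDeriv τ) (P.map T) y / convAvg (gaussianPDFReal 0 τ) (P.map T) y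
      set u4 := convAvg (gaussDeriv τ) (P.map T) y' / convAvg (gaussianPDFReal 0 τ) (P.map T) y'
      have r1 : |√β * (u2 - u1) + √(1 - β) * (u4 - u3)| ≤ |u2 - u1| + |u4 - u3| :=
        abs_mix_le hβ0 hβ1
      rw [abs_le] at r1 q3' ⊢
      constructor <;> linarith [r1.1, r1.2, q3'.1, q3'.2])
    (fun r x y hr hr1 hx hy => le_measureReal_square hτ hSm hTm h.law_left h.law_right h.indep
      h.indep_noise (hM h) hr hr1 hx hy)
    (h.integrable_scoreDefect_sq hδ hτ) hlt
  obtain ⟨B, hB⟩ := _root_.exists_affine_approx (κ := √δ) (R := R) hd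
    (Real.sqrt_le_sqrt h.lt_weight.le) a1 (Real.sqrt_le_sqrt (by linarith [h.weight_lt]))
    (by linarith) (continuous_score_add_gauss hτ hSm h.law_left h.indep_left) hdef
  have e : 12 * (η * √δ / 12) / √δ = η := by field_simp
  rw [e] at hB
  have g0 : |score P (S + ZS) 0| ≤ G := by rw [sS]; exact bS.1 0 (by simp)
  have g1 : |score P (S + ZS) 1| ≤ G := by rw [sS]; exact bS.1 1 (by simp)
  refine ⟨score P (S + ZS) 0, B, by linarith, ?_, hB⟩
  have h1 := hB 1 (by simpa using hR)
  rw [mul_one] at h1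
  rw [abs_le] at g0 g1 h1 ⊢
  constructor <;> linarith [g0.1, g0.2, g1.1, g1.2, h1.1, h1.2]

/-- A small score defect forces a small standardised Fisher information. -/
theorem NoisyPair.exists_fisherInfoSt_le {ψ : ℝ → ℝ} (hψ : Tendsto ψ atTop (𝓝 0)) {δ : ℝ}
    (hδ : 0 < δ) (K : ℝ) {τ : ℝ≥0} (hτ : τ ≠ 0) {κ : ℝ} (hκ : 0 < κ) :
    ∃ ε, 0 < ε ∧
      ∀ {Ω : Type*} [MeasurableSpace Ω] {P : Measure Ω} {S T ZS ZT : Ω → ℝ} {β : ℝ},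
      NoisyPair ψ δ K τ P S T ZS ZT β → scoreDelta P (S + ZS) (T + ZT) β < ε →
      fisherInfoSt P (S + ZS) ≤ κ := by
  have h0 : (0 : ℝ) < τ := by exact_mod_cast pos_iff_ne_zero.2 hτ
  obtain ⟨G, hG0, hG⟩ := NoisyPair.exists_affine_approx hψ hδ K hτ
  set V := (|K| + 1) * (τ : ℝ) with hV
  have hV0 : 0 < V := by positivity
  set m := ∫ z, z ^ 4 ∂(gaussianReal 0 τ) with hm
  have hm0 : 0 ≤ m := integral_nonneg fun z => by positivity
  -- With this `t` the fourth-moment term is at most `κ/4`; `m + 1` keeps the denominator positive.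
  -- The choices of `η` and of the tail level of `ψ` below cost `κ/4` each.
  set t := κ * τ ^ 2 / (8 * V * (m + 1)) with ht
  have ht0 : 0 < t := by positivity
  have hη0 : 0 < min 1 (κ / (4 * V)) := lt_min one_pos (by positivity)
  have hη1 : min 1 (κ / (4 * V)) ≤ 1 := min_le_left _ _
  have hη2 : min 1 (κ / (4 * V)) ≤ κ / (4 * V) := min_le_right _ _
  generalize min 1 (κ / (4 * V)) = η at hη0 hη1 hη2
  set D := 2 / (4 * t * τ ^ 2) + 8 * (G : ℝ) ^ 2 with hD
  have hD0 : 0 < D := by positivity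
  have hθ : |(0 : ℝ)| < κ / (4 * V * V * D) := by rw [abs_zero]; positivity
  -- The condition `1/√V ≤ R` makes the actual cut-off `R√V` at least `1`.
  obtain ⟨R, hR1, hR0, hR2⟩ := ((hψ.abs.eventually (ge_mem_nhds hθ)).and
    ((eventually_gt_atTop 0).and (eventually_ge_atTop (1 / √V)))).exists
  have hRV : 1 ≤ R * √V := by
    rwa [div_le_iff₀ (Real.sqrt_pos.2 hV0)] at hR2
  obtain ⟨ε, hε, hmain⟩ := hG (R * √V) η hRV hη0 hη1
  refine ⟨ε, hε, ?_⟩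
  intro Ω _ P S T ZS ZT β h hlt
  have := h.isProb
  obtain ⟨A, B, hA, hB, hAB⟩ := hmain h hlt
  have h1 := fisherInfoSt_add_gauss_le hτ h.memLp_left h.law_left h.indep_left A B
  have h2 := integral_sq_score_sub_affine_le hτ h.memLp_left h.law_left h.indep_left hRV ht0
    hA hB hAB
  have h3 := h.tail_left.integral_indicator_le hR0 hR1 h.variance_left_le
  have h4 := mul_le_mul_of_nonneg_left h3 hD0.le
  rw [← hm, ← hD] at h2
  refine h1.trans ((mul_le_mul h.variance_left_le (h2.trans (add_le_add_right h4 _))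
    (integral_nonneg fun ω => sq_nonneg _) hV0.le).trans ?_)
  rw [← hV]
  have p1 : V * η ^ 2 ≤ κ / 4 := by
    have : η ^ 2 ≤ κ / (4 * V) := by nlinarith
    calc V * η ^ 2 ≤ V * (κ / (4 * V)) := by gcongr
      _ = κ / 4 := by field_simp
  have p2 : V * (2 * ((t * m) / τ ^ 2)) ≤ κ / 4 := by
    have e : V * (2 * ((t * m) / τ ^ 2)) = κ / 4 * (m / (m + 1)) := by
      rw [ht]; field_simp; ring
    have : m / (m + 1) ≤ 1 := (div_le_one (by linarith)).2 (by linarith)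
    rw [e]
    nlinarith
  have p3 : V * (D * (V * (κ / (4 * V * V * D)))) = κ / 4 := by field_simp
  rw [mul_add, mul_add, p3]
  linarith

/-- The pairs `(Δ(X, Y, β), J_st(X))` attained by the family. -/
def attainedPairs.{u} (ψ : ℝ → ℝ) (δ K : ℝ) (τ : ℝ≥0) : Set (ℝ × ℝ) :=
  {q | ∃ (Ω : Type u) (_ : MeasurableSpace Ω) (P : Measure Ω) (S T ZS ZT : Ω → ℝ) (β : ℝ),
    NoisyPair ψ δ K τ P S T ZS ZT β ∧
      q = (scoreDelta P (S + ZS) (T + ZT) β, fisherInfoSt P (S + ZS))}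

end

theorem proposition2p6 (ψ : ℝ → ℝ) (hψ : Tendsto ψ atTop (𝓝 0)) (δ : ℝ) (hδ : 0 < δ)
    (K : ℝ) (τ : ℝ≥0) (hτ : 0 < τ) :
    ∃ ν : ℝ → ℝ, Tendsto ν (𝓝 0) (𝓝 0) ∧
      ∀ (Ω : Type*) [MeasurableSpace Ω] (P : Measure Ω) [IsProbabilityMeasure P]
        (S T ZS ZT X Y : Ω → ℝ) (β : ℝ),
        MemLp S 2 P → MemLp T 2 P →
        max (variance S P) (variance T P) ≤ K * τ →
        HasLaw ZS (gaussianReal 0 τ) P → HasLaw ZT (gaussianReal 0 τ) P →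
        IndepFun (fun ω => (S ω, T ω)) (fun ω => (ZS ω, ZT ω)) P → IndepFun ZS ZT P →
        X = S + ZS → Y = T + ZT →
        TailClass ψ P X → TailClass ψ P Y →
        δ < β → β < 1 - δ →
        (∃ p, IsC1Density P X p) ∧ (∃ p, IsC1Density P Y p) ∧
        (∃ p, IsC1Density P (mix β X Y) p) ∧
        Integrable (fun ω => score P X (X ω) ^ 2) P ∧
        Integrable (fun ω => scoreDefect P X Y β ω ^ 2) P ∧
        fisherInfoSt P X ≤ ν (scoreDelta P X Y β) := by
  obtain ⟨ν, hν, hle⟩ := exists_modulus (A := attainedPairs ψ δ K τ) (C := |K| + 1)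
    (by
      rintro _ ⟨Ω, _, P, S, T, ZS, ZT, β, h, rfl⟩
      exact h.fisherInfoSt_le hτ.ne')
    (by
      intro κ hκ
      obtain ⟨ε, hε, hmain⟩ := NoisyPair.exists_fisherInfoSt_le hψ hδ K hτ.ne' hκ
      refine ⟨ε, hε, ?_⟩
      rintro _ ⟨Ω, _, P, S, T, ZS, ZT, β, h, rfl⟩ hlt
      exact hmain h hlt)
  refine ⟨ν, hν, ?_⟩
  rintro Ω _ P hP S T ZS ZT X Y β hS hT hV hZS hZT hST hZ rfl rfl hX hY hβ0 hβ1
  have h : NoisyPair ψ δ K τ P S T ZS ZT β :=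
    ⟨hP, hS, hT, hV, hZS, hZT, hST, hZ, hX, hY, hβ0, hβ1⟩
  obtain ⟨d1, d2, d3⟩ := h.exists_isC1Density hδ hτ.ne'
  exact ⟨d1, d2, d3, h.integrable_score_sq hτ.ne', h.integrable_scoreDefect_sq hδ hτ.ne',
    hle _ ⟨Ω, _, P, S, T, ZS, ZT, β, h, rfl⟩⟩
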